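/- \textbf{Conventions.} For $n\ge 1$ let $[n]=\{1,\dots,n\}$, let $\mathfrak S_n$ be the set of permutations of $[n]$, and let $\mathfrak S=\bigcup_{n\ge1}\mathfrak S_n$. For $\sigma\in\mathfrak S_n$ and $I\subset[n]$ with $|I|=k$, let $\mathrm{pat}_I(\sigma)\in\mathfrak S_k$ be the permutation whose values are in the same relative order as $(\sigma(i))_{i\in I}$ (positions in increasing order). For $\pi\in\mathfrak S_k$ put $$\widetilde{\mathrm{occ}}(\pi,\sigma)=\binom nk^{-1}\,\bigl|\{I\subset[n]: |I|=k,\ \mathrm{pat}_I(\sigma)=\pi\}\bigr|,$$ with value $0$ if $n<k$. A permuton is a Borel probability measure on $[0,1]^2$ whose two marginals are the Lebesgue measure on $[0,1]$; the set $\mathcal M$ of permutons carries the topology of weak convergence and its Borel $\sigma$-algebra, and a random permuton is a random element of $\mathcal M$. For $\sigma\in\mathfrak S_n$, $\mu_\sigma$ is the permuton $\mu_\sigma(dx\,dy)=n\,\mathbf 1_{\sigma(\lceil xn\rceil)=\lceil yn\rceil}\,dx\,dy$. For $k$ points $(x_i,y_i)$ of $[0,1]^2$ with distinct $x_i$'s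 and distinct $y_i$'s, $\mathrm{Perm}(\vec x,\vec y)\in\mathfrak S_k$ is the permutation whose values are in the same relative order as the $y$-coordinates of the points listed by increasing $x$-coordinate. For $\pi\in\mathfrak S_k$ and $\mu\in\mathcal M$, $\widetilde{\mathrm{occ}}(\pi,\mu)$ is the probability that $\mathrm{Perm}(\vec x,\vec y)=\pi$ when $(x_1,y_1),\dots,(x_k,y_k)$ are independent with common distribution $\mu$. For a random permuton $\boldsymbol\mu$, $\vec{\mathbf m}_k$ denotes $k$ random points of $[0,1]^2$ which, conditionally on $\boldsymbol\mu$, are independent with common distribution $\boldsymbol\mu$, and $\mathrm{Perm}(\vec{\mathbf m}_k,\boldsymbol\mu)$ is the random permutation of size $k$ that they induce. \textbf{Theorem.} For every $n\ge1$ let $\boldsymbol\sigma_n$ be a random permutation of size $n$, and for all $1\le k\le n$ let $\boldsymbol I_{n,k}$ be a uniform random subset of $[n]$ with $k$ elements, independent of $\boldsymbol\sigma_n$. The following assertions are equivalent. \begin{enumerate} \item[(a)] $(\mu_{\boldsymbol\sigma_n})_n$ converges in distribution, for the weak topology on $\mathcal M$, to some random permuton $\boldsymbol\mu$. \item[(b)]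 The random infinite vectors $(\widetilde{\mathrm{occ}}(\pi,\boldsymbol\sigma_n))_{\pi\in\mathfrak S}$ converge in distribution in the product topology on $\mathbb R^{\mathfrak S}$, as $n\to\infty$, to some random infinite vector $(\boldsymbol\Lambda_\pi)_{\pi\in\mathfrak S}$. \item[(c)] For every $\pi\in\mathfrak S$ there is $\Delta_\pi\ge0$ such that $\mathbb E[\widetilde{\mathrm{occ}}(\pi,\boldsymbol\sigma_n)]\to\Delta_\pi$ as $n\to\infty$. \item[(d)] For every $k\ge1$, the sequence $(\mathrm{pat}_{\boldsymbol I_{n,k}}(\boldsymbol\sigma_n))_{n\ge k}$ of random permutations of size $k$ converges in distribution to some random permutation $\boldsymbol\rho_k$. \end{enumerate} Whenever these assertions hold, the limits satisfy $(\boldsymbol\Lambda_\pi)_{\pi\in\mathfrak S}\stackrel d=(\widetilde{\mathrm{occ}}(\pi,\boldsymbol\mu))_{\pi\in\mathfrak S}$ and, for every $k\ge1$ and $\pi\in\mathfrak S_k$, $$\mathbb P(\boldsymbol\rho_k=\pi)=\Delta_\pi=\mathbb E[\boldsymbol\Lambda_\pi]=\mathbb E[\widetilde{\mathrm{occ}}(\pi,\boldsymbol\mu)]=\mathbb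 P(\mathrm{Perm}(\vec{\mathbf m}_k,\boldsymbol\mu)=\pi).$$ -/

import Mathlib

open MeasureTheory ProbabilityTheory Filter Topology

noncomputable section

/-! ## Permutations and patterns

A permutation of size `n` is an element of `Equiv.Perm (Fin n)`; the position and value `i : Fin n`
stands for `i + 1` in `{1, …, n}`. Sizes are positive integers. The finite set of permutations of a
given size carries the discrete topology and the discrete σ-algebra. -/

instance permFinTopologicalSpace (n : ℕ) : TopologicalSpace (Equiv.Perm (Fin n)) := ⊥

instance permFinDiscreteTopology (n : ℕ) : DiscreteTopology (Equiv.Perm (Fin n)) := ⟨rfl⟩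

instance permFinMeasurableSpace (n : ℕ) : MeasurableSpace (Equiv.Perm (Fin n)) := ⊤

instance permFinDiscreteMeasurableSpace (n : ℕ) :
    DiscreteMeasurableSpace (Equiv.Perm (Fin n)) := ⟨fun _ => trivial⟩

/-- The set of all permutations of all positive sizes. -/
abbrev AllPerms : Type := Σ k : ℕ+, Equiv.Perm (Fin k)

/-- The permutation whose values are in the same relative order as the (distinct) values of `f`:
`relativeOrder f i` is the rank of `f i` among all the values of `f`. -/
def relativeOrder {k : ℕ} {α : Type*} [LinearOrder α] (f : Fin k → α) : Equiv.Perm (Fin k) :=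
  (Tuple.sort f)⁻¹

theorem relativeOrder_lt_iff {k : ℕ} {α : Type*} [LinearOrder α] {f : Fin k → α}
    (hf : Function.Injective f) (i j : Fin k) :
    relativeOrder f i < relativeOrder f j ↔ f i < f j := by
  have hm : StrictMono (f ∘ Tuple.sort f) :=
    (Tuple.monotone_sort f).strictMono_of_injective (hf.comp (Tuple.sort f).injective)
  rw [← hm.lt_iff_lt]
  simp [relativeOrder]

/-- The pattern `pat_I(σ)` induced by `σ` at the set of positions `I`, where `I` has `k` elements. -/
def inducedPattern {n k : ℕ} (σ : Equiv.Perm (Fin n)) (I : Set.powersetCard (Fin n) k) :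
    Equiv.Perm (Fin k) :=
  relativeOrder fun j => σ ((I : Finset (Fin n)).orderEmbOfFin I.2 j)

/-- The number of occurrences of the pattern `π` in `σ`. -/
def occCount {n k : ℕ} (π : Equiv.Perm (Fin k)) (σ : Equiv.Perm (Fin n)) : ℕ :=
  Nat.card {I : Set.powersetCard (Fin n) k // inducedPattern σ I = π}

/-- The density of the pattern `π` in the permutation `σ` (equal to `0` when `n < k`). -/
def occDensity {n k : ℕ} (π : Equiv.Perm (Fin k)) (σ : Equiv.Perm (Fin n)) : ℝ :=
  (occCount π σ : ℝ) / (n.choose k : ℝ)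

/-! ## Permutons -/

/-- The unit square `[0,1]²`. -/
abbrev UnitSquare : Type := unitInterval × unitInterval

/-- Permutons: probability measures on the unit square whose two marginals are both the Lebesgue
measure on `[0,1]`. -/
def Permuton : Type :=
  {μ : ProbabilityMeasure UnitSquare //
    (μ : Measure UnitSquare).map Prod.fst = volume ∧
    (μ : Measure UnitSquare).map Prod.snd = volume}

namespace Permuton

/-- The measure on the unit square underlying a permuton. -/
def toMeasure (μ : Permuton) : Measure UnitSquare := (μ.1 : Measure UnitSquare)

instance (μ : Permuton) : IsProbabilityMeasure μ.toMeasure :=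
  inferInstanceAs (IsProbabilityMeasure (μ.1 : Measure UnitSquare))

/-- The topology of weak convergence. -/
instance : TopologicalSpace Permuton := instTopologicalSpaceSubtype

/-- The Borel σ-algebra of the weak topology. -/
instance : MeasurableSpace Permuton := borel Permuton

instance : BorelSpace Permuton := ⟨rfl⟩

theorem measurable_toMeasure : Measurable toMeasure := by
  refine Measurable.measure_of_isPiSystem_of_isProbabilityMeasure
    (S := {s : Set UnitSquare | IsClosed s}) ?_ isPiSystem_isClosed ?_
  · rw [← borel_eq_generateFrom_isClosed]
    exact BorelSpace.measurable_eq
  · intro F hF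
    refine measurable_of_tendsto_metrizable
      (f := fun n (ν : Permuton) => ∫⁻ z, (IsClosed.apprSeq hF n z : ENNReal) ∂ν.toMeasure) ?_ ?_
    · intro n
      have hc : Continuous fun μ : Permuton => μ.1 := continuous_subtype_val
      have h := ProbabilityMeasure.continuous_lintegral_boundedContinuousFunction
        (IsClosed.apprSeq hF n)
      exact (h.comp hc).measurable
    · rw [tendsto_pi_nhds]
      intro ν
      exact HasOuterApproxClosed.tendsto_lintegral_apprSeq hF ν.toMeasure

/-- The Markov kernel sending a permuton `μ` to the law `μ ⊗ ⋯ ⊗ μ` of `k` independent points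
with common distribution `μ`. -/
def sampleKernel (k : ℕ) : Kernel Permuton (Fin k → UnitSquare) where
  toFun μ := Measure.pi fun _ => μ.toMeasure
  measurable' := by
    refine Measurable.measure_of_isPiSystem_of_isProbabilityMeasure generateFrom_pi.symm
      isPiSystem_pi ?_
    rintro _ ⟨s, hs, rfl⟩
    simp only [Measure.pi_pi]
    refine Finset.measurable_prod _ fun i _ => ?_
    have hi : MeasurableSet (s i) := hs i (Set.mem_univ i)
    exact (Measure.measurable_coe hi).comp measurable_toMeasure

instance (k : ℕ) : IsMarkovKernel (sampleKernel k) :=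
  ⟨fun μ => inferInstanceAs (IsProbabilityMeasure (Measure.pi fun _ : Fin k => μ.toMeasure))⟩

/-- `Perm(x⃗, y⃗)`: reorder the points `z i = (x i, y i)` by increasing first coordinate and take
the relative order of the second coordinates. This is the usual notion as soon as the `x i` are
distinct and the `y i` are distinct, which is almost surely the case for independent points
sampled from a permuton. -/
def permOfPoints {k : ℕ} (z : Fin k → UnitSquare) : Equiv.Perm (Fin k) :=
  relativeOrder fun j => (z (Tuple.sort (fun i => (z i).1) j)).2

/-- The density of the pattern `π` in the permuton `μ`: the probability that `k` independent
points with common distribution `μ` induce the permutation `π`. -/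
def occDensity {k : ℕ} (π : Equiv.Perm (Fin k)) (μ : Permuton) : ℝ :=
  (Measure.pi fun _ : Fin k => μ.toMeasure).real {z | permOfPoints z = π}

/-- Given the law `Q` of a random permuton `μ`, the joint law of `(μ, m)`, where `m` consists of
`k` points that are, conditionally on `μ`, independent with common distribution `μ`. -/
def jointSampleLaw (Q : Measure Permuton) (k : ℕ) : Measure (Permuton × (Fin k → UnitSquare)) :=
  Q ⊗ₘ sampleKernel k

/-- The density of the permuton associated with `σ`: the value is `n` at the points `(x, y)` with
`σ(⌈x n⌉) = ⌈y n⌉`, and `0` elsewhere. -/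
def diagramDensity {n : ℕ} (σ : Equiv.Perm (Fin n)) (z : UnitSquare) : ENNReal :=
  open scoped Classical in
  if ∃ i : Fin n, ⌈(z.1 : ℝ) * n⌉₊ = (i : ℕ) + 1 ∧ ⌈(z.2 : ℝ) * n⌉₊ = (σ i : ℕ) + 1
  then (n : ENNReal) else 0

/-- The measure with density `diagramDensity σ` with respect to Lebesgue measure. -/
def diagramMeasure {n : ℕ} (σ : Equiv.Perm (Fin n)) : Measure UnitSquare :=
  (volume : Measure UnitSquare).withDensity (diagramDensity σ)

/-- The cell `((j-1)/n, j/n]`, indexed from `0`. -/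
def cell (n : ℕ) (j : Fin n) : Set unitInterval := {x | ⌈(x : ℝ) * n⌉₊ = (j : ℕ) + 1}

theorem measurableSet_cell (n : ℕ) (j : Fin n) : MeasurableSet (cell n j) := by
  have h : Measurable fun x : unitInterval => ⌈(x : ℝ) * n⌉₊ := by fun_prop
  exact h (measurableSet_singleton _)

theorem volume_cell {n : ℕ} (j : Fin n) : (n : ENNReal) * volume (cell n j) = 1 := by
  have hn : 0 < n := j.pos
  have hn' : (0 : ℝ) < n := by exact_mod_cast hn
  have hj : ((j : ℕ) : ℝ) + 1 ≤ n := by exact_mod_cast j.2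
  have ha : ((j : ℕ) : ℝ) / n ∈ unitInterval :=
    ⟨by positivity, by rw [div_le_one hn']; linarith⟩
  have hb : (((j : ℕ) : ℝ) + 1) / n ∈ unitInterval :=
    ⟨by positivity, by rw [div_le_one hn']; linarith⟩
  have h : cell n j = Set.Ioc ⟨_, ha⟩ ⟨_, hb⟩ := by
    ext x
    simp only [cell, Set.mem_ofPred_eq, Set.mem_Ioc, ← Subtype.coe_lt_coe, ← Subtype.coe_le_coe]
    rw [Nat.ceil_eq_iff (by omega), div_lt_iff₀ hn', le_div_iff₀ hn']
    push_cast
    simp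
  rw [h, unitInterval.volume_Ioc, ← ENNReal.ofReal_natCast, ← ENNReal.ofReal_mul hn'.le]
  rw [← ENNReal.ofReal_one]
  congr 1
  field_simp
  ring

theorem pairwise_disjoint_cell (n : ℕ) : Pairwise (Function.onFun Disjoint (cell n)) := by
  intro i j hij
  refine Set.disjoint_left.2 fun x hi hj => hij ?_
  simp only [cell, Set.mem_ofPred_eq] at hi hj
  ext
  omega

theorem sum_restrict_cell {n : ℕ} (hn : 0 < n) :
    ∑ i : Fin n, (volume : Measure unitInterval).restrict (cell n i) = volume := by
  have hn' : (0 : ℝ) < n := by exact_mod_cast hn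
  rw [← Measure.sum_fintype,
    ← Measure.restrict_iUnion (pairwise_disjoint_cell n) (measurableSet_cell n)]
  refine Measure.restrict_eq_self_of_ae_mem ?_
  have h0 : ∀ᵐ x : unitInterval, x ≠ 0 := by simp [ae_iff]
  filter_upwards [h0] with x hx
  have hx0 : (0 : ℝ) < x := unitInterval.pos_iff_ne_zero.2 hx
  have h1 : 0 < ⌈(x : ℝ) * n⌉₊ := Nat.ceil_pos.2 (by positivity)
  have h2 : ⌈(x : ℝ) * n⌉₊ ≤ n := Nat.ceil_le.2 (mul_le_of_le_one_left hn'.le x.2.2)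
  exact Set.mem_iUnion.2 ⟨⟨⌈(x : ℝ) * n⌉₊ - 1, by omega⟩, by simp [cell]; omega⟩

theorem diagramDensity_eq_sum {n : ℕ} (σ : Equiv.Perm (Fin n)) :
    diagramDensity σ = ∑ i : Fin n, (cell n i ×ˢ cell n (σ i)).indicator fun _ => (n : ENNReal) := by
  classical
  funext z
  rw [Finset.sum_apply]
  by_cases h : ∃ i : Fin n, z ∈ cell n i ×ˢ cell n (σ i)
  · obtain ⟨i, hi⟩ := h
    rw [Finset.sum_eq_single i]
    · rw [Set.indicator_of_mem hi, diagramDensity, if_pos ⟨i, hi.1, hi.2⟩]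
    · intro j _ hj
      refine Set.indicator_of_notMem (fun hz => ?_) _
      exact Set.disjoint_left.1 (pairwise_disjoint_cell n hj) hz.1 hi.1
    · simp
  · rw [diagramDensity, if_neg, Finset.sum_eq_zero]
    · intro i _
      exact Set.indicator_of_notMem (fun hz => h ⟨i, hz⟩) _
    · rintro ⟨i, h1, h2⟩
      exact h ⟨i, h1, h2⟩

theorem diagramMeasure_eq_sum {n : ℕ} (σ : Equiv.Perm (Fin n)) :
    diagramMeasure σ = ∑ i : Fin n, (n : ENNReal) •
      ((volume : Measure unitInterval).restrict (cell n i)).prod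
        ((volume : Measure unitInterval).restrict (cell n (σ i))) := by
  have hm : ∀ i : Fin n, MeasurableSet (cell n i ×ˢ cell n (σ i)) := fun i =>
    (measurableSet_cell n i).prod (measurableSet_cell n (σ i))
  have key : ∀ s : Finset (Fin n),
      (volume : Measure UnitSquare).withDensity
        (∑ i ∈ s, (cell n i ×ˢ cell n (σ i)).indicator fun _ => (n : ENNReal)) =
      ∑ i ∈ s, (n : ENNReal) • ((volume : Measure unitInterval).restrict (cell n i)).prod
        ((volume : Measure unitInterval).restrict (cell n (σ i))) := by
    classical
    intro s
    induction s using Finset.induction_on with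
    | empty => simp
    | insert i s hi ih =>
      rw [Finset.sum_insert hi, Finset.sum_insert hi, ← ih,
        withDensity_add_left (measurable_const.indicator (hm i)), withDensity_indicator (hm i),
        withDensity_const, Measure.prod_restrict]
      rfl
  rw [diagramMeasure, diagramDensity_eq_sum]
  exact key Finset.univ

theorem map_fst_diagramMeasure {n : ℕ} (hn : 0 < n) (σ : Equiv.Perm (Fin n)) :
    (diagramMeasure σ).map Prod.fst = volume := by
  rw [diagramMeasure_eq_sum, ← Measure.sum_fintype,
    Measure.map_sum measurable_fst.aemeasurable, Measure.sum_fintype]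
  refine Eq.trans ?_ (sum_restrict_cell hn)
  refine Finset.sum_congr rfl fun i _ => ?_
  rw [Measure.map_smul, Measure.map_fst_prod, Measure.restrict_apply_univ, smul_smul,
    volume_cell, one_smul]

theorem map_snd_diagramMeasure {n : ℕ} (hn : 0 < n) (σ : Equiv.Perm (Fin n)) :
    (diagramMeasure σ).map Prod.snd = volume := by
  rw [diagramMeasure_eq_sum, ← Measure.sum_fintype,
    Measure.map_sum measurable_snd.aemeasurable, Measure.sum_fintype]
  refine Eq.trans ?_ (sum_restrict_cell hn)
  rw [← Equiv.sum_comp σ fun i => (volume : Measure unitInterval).restrict (cell n i)]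
  refine Finset.sum_congr rfl fun i _ => ?_
  rw [Measure.map_smul, Measure.map_snd_prod, Measure.restrict_apply_univ, smul_smul,
    volume_cell, one_smul]

theorem isProbabilityMeasure_diagramMeasure {n : ℕ} (hn : 0 < n) (σ : Equiv.Perm (Fin n)) :
    IsProbabilityMeasure (diagramMeasure σ) := by
  constructor
  rw [← Set.preimage_univ (f := (Prod.fst : UnitSquare → unitInterval)),
    ← Measure.map_apply measurable_fst MeasurableSet.univ, map_fst_diagramMeasure hn]
  exact measure_univ

/-- The permuton `μ_σ` associated with a permutation `σ` of positive size. -/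
def ofPerm {n : ℕ+} (σ : Equiv.Perm (Fin n)) : Permuton :=
  ⟨⟨diagramMeasure σ, isProbabilityMeasure_diagramMeasure n.pos σ⟩,
    map_fst_diagramMeasure n.pos σ, map_snd_diagramMeasure n.pos σ⟩

end Permuton

end

noncomputable section

/-! ## Relative orders -/

/-! The space of permutons is compact and metrizable, and on it the pattern densities behave like
moments. Each density is continuous (`continuous_occDensity`), because `k` independent points of a
permuton almost surely have distinct coordinates and the induced pattern is locally constant at such
configurations. The product of two densities is a linear combination of densities of larger patterns
(`occMap_mul_occMap_mem`), so their span is an algebra. The densities separate permutons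
(`eq_of_occDensity_eq`), because every mixed moment of a permuton is the probability of an event
about relative orders, hence a combination of densities. It follows that expected densities
determine the law of a random permuton (`measure_eq_of_integral_occDensity_eq`). If they converge,
all cluster points of the laws coincide, and compactness gives convergence
(`exists_tendstoInDistribution_ofPerm`).

Permutations enter through `abs_occDensity_sub_le`: the densities of a permutation of size `n` and
of its permuton differ by at most the probability that `k` uniform draws from `n` cells collide.
This is uniform over permutations of that size and tends to zero, so it survives randomization.
Finally, `inducedPattern_real_eq` identifies the expected density with the law of the pattern at
uniform random positions, which links (c) and (d). -/

theorem Equiv.Perm.eq_one_of_strictMono {k : ℕ} {τ : Equiv.Perm (Fin k)} (h : StrictMono τ) :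
    τ = 1 := by
  have : h.orderIsoOfSurjective _ τ.surjective = OrderIso.refl _ := Subsingleton.elim _ _
  ext1 i
  exact DFunLike.congr_fun this i

/-- One implication is enough because `τ` compares any two distinct indices strictly: this makes `f`
injective, and `relativeOrder f * τ⁻¹` is then an increasing permutation, hence trivial. -/
theorem eq_relativeOrder {k : ℕ} {α : Type*} [LinearOrder α] {f : Fin k → α}
    {τ : Equiv.Perm (Fin k)} (h : ∀ i j, τ i < τ j → f i < f j) :
    Function.Injective f ∧ relativeOrder f = τ := by
  have hf : Function.Injective f := by
    intro i j hij
    by_contra hne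
    rcases lt_or_gt_of_ne (τ.injective.ne hne) with h' | h'
    · exact (h _ _ h').ne hij
    · exact (h _ _ h').ne' hij
  refine ⟨hf, ?_⟩
  have : relativeOrder f * τ⁻¹ = 1 := by
    refine Equiv.Perm.eq_one_of_strictMono fun i j hij => ?_
    refine (relativeOrder_lt_iff hf _ _).2 (h _ _ ?_)
    simpa using hij
  exact mul_inv_eq_one.1 this

theorem injective_and_relativeOrder_eq_iff {k : ℕ} {α : Type*} [LinearOrder α] {f : Fin k → α}
    {τ : Equiv.Perm (Fin k)} :
    (Function.Injective f ∧ relativeOrder f = τ) ↔ ∀ i j, τ i < τ j → f i < f j := by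
  refine ⟨?_, eq_relativeOrder⟩
  rintro ⟨hf, rfl⟩ i j hij
  exact (relativeOrder_lt_iff hf i j).1 hij

theorem relativeOrder_le_iff {k : ℕ} {α : Type*} [LinearOrder α] {f : Fin k → α}
    (hf : Function.Injective f) (i j : Fin k) :
    relativeOrder f i ≤ relativeOrder f j ↔ f i ≤ f j := by
  simpa using (relativeOrder_lt_iff hf j i).not

theorem relativeOrder_comp_perm {k : ℕ} {α : Type*} [LinearOrder α] {f : Fin k → α}
    (hf : Function.Injective f) (τ : Equiv.Perm (Fin k)) :
    relativeOrder (f ∘ τ) = relativeOrder f * τ :=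
  (eq_relativeOrder (f := f ∘ τ) (τ := relativeOrder f * τ) fun _ _ hij =>
    (relativeOrder_lt_iff hf _ _).1 hij).2

/-- The relative order only depends on the comparisons between the values. -/
theorem relativeOrder_congr {k : ℕ} {α β : Type*} [LinearOrder α] [LinearOrder β]
    {f : Fin k → α} {g : Fin k → β} (hg : Function.Injective g)
    (h : ∀ i j, g i < g j → f i < f j) : relativeOrder f = relativeOrder g :=
  (eq_relativeOrder fun _ _ hij => h _ _ ((relativeOrder_lt_iff hg _ _).1 hij)).2

theorem relativeOrder_comp_relativeOrder {k m : ℕ} {α : Type*} [LinearOrder α] {f : Fin k → α}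
    (hf : Function.Injective f) {e : Fin m → Fin k} (he : Function.Injective e) :
    relativeOrder (f ∘ e) = relativeOrder (relativeOrder f ∘ e) :=
  relativeOrder_congr ((relativeOrder f).injective.comp he)
    fun _ _ hij => (relativeOrder_lt_iff hf _ _).1 hij

/-- Each fibre is cut out by finitely many comparisons between coordinates, with ties broken by
index. -/
theorem measurable_sort {k : ℕ} : Measurable fun f : Fin k → unitInterval => Tuple.sort f := by
  refine measurable_to_countable' fun τ => ?_
  have : (fun f : Fin k → unitInterval => Tuple.sort f) ⁻¹' {τ} =
      {f | (∀ i j, i ≤ j → f (τ i) ≤ f (τ j)) ∧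
        ∀ i j, i < j → f (τ i) = f (τ j) → τ i < τ j} := by
    ext f
    simp only [Set.mem_preimage, Set.mem_singleton_iff]
    rw [eq_comm, Tuple.eq_sort_iff]
    rfl
  rw [this]
  measurability

theorem measurable_relativeOrder {k : ℕ} :
    Measurable fun f : Fin k → unitInterval => relativeOrder f :=
  (Measurable.of_discrete (f := fun τ : Equiv.Perm (Fin k) => τ⁻¹)).comp measurable_sort

namespace Permuton

/-! ## Configurations of points in general position -/

/-- The configurations of points with distinct first and distinct second coordinates. -/
def generic (k : ℕ) : Set (Fin k → UnitSquare) :=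
  {z | Function.Injective (fun i => (z i).1) ∧ Function.Injective fun i => (z i).2}

/-- The relative orders of the first and of the second coordinates. -/
def orders {k : ℕ} (z : Fin k → UnitSquare) : Equiv.Perm (Fin k) × Equiv.Perm (Fin k) :=
  (relativeOrder fun i => (z i).1, relativeOrder fun i => (z i).2)

/-- This replaces sorting by a group formula, in which relabelling the points multiplies both orders
on the right and visibly cancels. -/
theorem permOfPoints_eq {k : ℕ} {z : Fin k → UnitSquare} (hz : z ∈ generic k) :
    permOfPoints z = (orders z).2 * (orders z).1⁻¹ := by
  have := relativeOrder_comp_perm hz.2 (Tuple.sort fun i => (z i).1)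
  rwa [← inv_inv (Tuple.sort fun i => (z i).1)] at this

theorem measurable_orders {k : ℕ} : Measurable (orders (k := k)) := by
  have h1 : Measurable fun z : Fin k → UnitSquare => fun i => (z i).1 := by fun_prop
  have h2 : Measurable fun z : Fin k → UnitSquare => fun i => (z i).2 := by fun_prop
  exact (measurable_relativeOrder.comp h1).prodMk (measurable_relativeOrder.comp h2)

theorem measurable_permOfPoints {k : ℕ} : Measurable (permOfPoints (k := k)) := by
  have h1 : Measurable fun z : Fin k → UnitSquare => Tuple.sort fun i => (z i).1 :=
    measurable_sort.comp (by fun_prop)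
  refine measurable_to_countable' fun π => ?_
  have : permOfPoints (k := k) ⁻¹' {π} = ⋃ τ : Equiv.Perm (Fin k),
      {z | (Tuple.sort fun i => (z i).1) = τ} ∩ {z | (relativeOrder fun j => (z (τ j)).2) = π} := by
    ext z
    simp [permOfPoints]
  rw [this]
  refine MeasurableSet.iUnion fun τ => (h1 (measurableSet_singleton τ)).inter ?_
  have h2 : Measurable fun z : Fin k → UnitSquare => fun j => (z (τ j)).2 :=
    measurable_pi_lambda _ fun j => (measurable_pi_apply (τ j)).snd
  exact measurable_relativeOrder.comp h2 (measurableSet_singleton π)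

/-- Being generic with prescribed orders amounts to finitely many strict inequalities between
coordinates. -/
theorem isOpen_generic_inter_orders {k : ℕ}
    (A : Set (Equiv.Perm (Fin k) × Equiv.Perm (Fin k))) :
    IsOpen {z | z ∈ generic k ∧ orders z ∈ A} := by
  have : {z | z ∈ generic k ∧ orders z ∈ A} = ⋃ p ∈ A,
      {z : Fin k → UnitSquare | (∀ i j, p.1 i < p.1 j → (z i).1 < (z j).1) ∧
        ∀ i j, p.2 i < p.2 j → (z i).2 < (z j).2} := by
    ext z
    simp only [Set.mem_iUnion, Set.mem_ofPred_eq, exists_prop,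
      ← injective_and_relativeOrder_eq_iff (f := fun i => (z i).1),
      ← injective_and_relativeOrder_eq_iff (f := fun i => (z i).2)]
    constructor
    · rintro ⟨hz, hA⟩
      exact ⟨orders z, hA, ⟨hz.1, rfl⟩, hz.2, rfl⟩
    · rintro ⟨p, hp, ⟨h1, h2⟩, h3, h4⟩
      refine ⟨⟨h1, h3⟩, ?_⟩
      rwa [orders, h2, h4]
  rw [this]
  have h : ∀ (τ : Equiv.Perm (Fin k)) (c : UnitSquare → unitInterval), Continuous c →
      IsOpen {z : Fin k → UnitSquare | ∀ i j, τ i < τ j → c (z i) < c (z j)} := by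
    intro τ c hc
    simp only [Set.ofPred_forall]
    exact isOpen_iInter_of_finite fun i => isOpen_iInter_of_finite fun j =>
      isOpen_iInter_of_finite fun _ => isOpen_lt (by fun_prop) (by fun_prop)
  exact isOpen_biUnion fun p _ => (h p.1 _ continuous_fst).inter (h p.2 _ continuous_snd)

/-- The pattern is locally constant at a generic configuration, so no such point lies on the
frontier. -/
theorem frontier_permOfPoints_subset {k : ℕ} (π : Equiv.Perm (Fin k)) :
    frontier {z | permOfPoints z = π} ⊆ (generic k)ᶜ := by
  intro z hz hg
  have key : ∀ B : Set (Equiv.Perm (Fin k)), permOfPoints z ∈ B →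
      {w | permOfPoints w ∈ B} ∈ 𝓝 z := by
    intro B hB
    have ho := isOpen_generic_inter_orders {p : Equiv.Perm (Fin k) × Equiv.Perm (Fin k) |
      p.2 * p.1⁻¹ ∈ B}
    refine mem_of_superset (ho.mem_nhds ⟨hg, ?_⟩) ?_
    · rw [permOfPoints_eq hg] at hB
      exact hB
    · rintro w ⟨hw, hwB⟩
      simpa [permOfPoints_eq hw] using hwB
  rw [frontier_eq_closure_inter_closure] at hz
  by_cases h : permOfPoints z = π
  · have := mem_closure_iff_nhds.1 hz.2 _ (key {π} h)
    obtain ⟨w, hw1, hw2⟩ := this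
    exact hw2 hw1
  · have := mem_closure_iff_nhds.1 hz.1 _ (key {π}ᶜ h)
    obtain ⟨w, hw1, hw2⟩ := this
    exact hw1 hw2

/-! ## The space of permutons -/

instance : T2Space Permuton := inferInstanceAs (T2Space {μ : ProbabilityMeasure UnitSquare //
    (μ : Measure UnitSquare).map Prod.fst = volume ∧
    (μ : Measure UnitSquare).map Prod.snd = volume})

instance : TopologicalSpace.MetrizableSpace Permuton :=
  (Topology.IsEmbedding.subtypeVal (p := fun μ : ProbabilityMeasure UnitSquare =>
    (μ : Measure UnitSquare).map Prod.fst = volume ∧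
    (μ : Measure UnitSquare).map Prod.snd = volume)).metrizableSpace

/-- Taking marginals is weakly continuous, so the marginal conditions define a closed subset of the
compact space of probability measures on the square. -/
instance : CompactSpace Permuton := by
  let ν : ProbabilityMeasure unitInterval := ⟨volume, inferInstance⟩
  have hν : ∀ ρ : ProbabilityMeasure unitInterval, ρ = ν ↔ (ρ : Measure unitInterval) = volume :=
    fun ρ => ⟨fun h => by rw [h]; rfl, fun h => Subtype.ext h⟩
  have h : IsClosed {μ : ProbabilityMeasure UnitSquare |
      (μ : Measure UnitSquare).map Prod.fst = volume ∧
      (μ : Measure UnitSquare).map Prod.snd = volume} := by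
    have h1 := ProbabilityMeasure.continuous_map (Ω := UnitSquare) continuous_fst
    have h2 := ProbabilityMeasure.continuous_map (Ω := UnitSquare) continuous_snd
    convert! (isClosed_eq h1 (continuous_const (y := ν))).inter
      (isClosed_eq h2 (continuous_const (y := ν))) using 1
    ext μ
    simp only [Set.mem_ofPred_eq, Set.mem_inter_iff, hν]
    rfl
  exact isCompact_iff_compactSpace.1 h.isCompact

instance : PolishSpace Permuton := by
  let := TopologicalSpace.metrizableSpaceMetric Permuton
  infer_instance

theorem map_fst_toMeasure (μ : Permuton) : μ.toMeasure.map Prod.fst = volume := μ.2.1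

theorem map_snd_toMeasure (μ : Permuton) : μ.toMeasure.map Prod.snd = volume := μ.2.2

theorem ext_toMeasure {μ ν : Permuton} (h : μ.toMeasure = ν.toMeasure) : μ = ν :=
  Subtype.ext (Subtype.ext h)

/-- The law of `k` independent points with common distribution `μ`. -/
abbrev sample (μ : Permuton) (k : ℕ) : Measure (Fin k → UnitSquare) :=
  Measure.pi fun _ => μ.toMeasure

/-! ## Almost sure genericity and exchangeability -/

/-- The two coordinates are independent and uniform, and the diagonal is null by Fubini. -/
theorem sample_coord_ne (μ : Permuton) {k : ℕ} {c : UnitSquare → unitInterval} (hc : Measurable c)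
    (hμ : μ.toMeasure.map c = volume) {i j : Fin k} (hij : i ≠ j) :
    ∀ᵐ z ∂μ.sample k, c (z i) ≠ c (z j) := by
  have hi : iIndepFun (fun (i : Fin k) (z : Fin k → UnitSquare) => c (z i)) (μ.sample k) :=
    iIndepFun_pi fun _ => hc.aemeasurable
  have hm : ∀ i : Fin k, Measurable fun z : Fin k → UnitSquare => c (z i) := fun i => by fun_prop
  have hl : ∀ i : Fin k, (μ.sample k).map (fun z => c (z i)) = volume := by
    intro i
    rw [← hμ, ← (measurePreserving_eval (fun _ : Fin k => μ.toMeasure) i).map_eq,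
      Measure.map_map hc (measurable_pi_apply i)]
    rfl
  have h2 := (indepFun_iff_map_prod_eq_prod_map_map (hm i).aemeasurable
    (hm j).aemeasurable).1 (hi.indepFun hij)
  rw [hl, hl] at h2
  have hd : MeasurableSet {p : unitInterval × unitInterval | p.1 = p.2} :=
    measurableSet_eq_fun measurable_fst measurable_snd
  have h0 : (volume.prod volume) {p : unitInterval × unitInterval | p.1 = p.2} = 0 := by
    rw [Measure.measure_prod_null hd]
    refine Eventually.of_forall fun x => ?_
    have : Prod.mk x ⁻¹' {p : unitInterval × unitInterval | p.1 = p.2} = {x} := by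
      ext y
      simp [eq_comm]
    simp [this]
  rw [← h2, Measure.map_apply ((hm i).prodMk (hm j)) hd] at h0
  rw [ae_iff]
  simpa using h0

theorem ae_generic (μ : Permuton) (k : ℕ) : ∀ᵐ z ∂μ.sample k, z ∈ generic k := by
  have key : ∀ c : UnitSquare → unitInterval, Measurable c → μ.toMeasure.map c = volume →
      ∀ᵐ z ∂μ.sample k, Function.Injective fun i => c (z i) := by
    intro c hc hμ
    have h : ∀ i j : Fin k, ∀ᵐ z ∂μ.sample k, c (z i) = c (z j) → i = j := by
      intro i j
      by_cases hij : i = j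
      · simp [hij]
      · filter_upwards [μ.sample_coord_ne hc hμ hij] with z hz h using absurd h hz
    filter_upwards [ae_all_iff.2 fun i => ae_all_iff.2 (h i)] with z hz i j hij using hz i j hij
  filter_upwards [key _ measurable_fst μ.map_fst_toMeasure,
    key _ measurable_snd μ.map_snd_toMeasure] with z h1 h2 using ⟨h1, h2⟩

theorem measurePreserving_comp_perm (μ : Permuton) {k : ℕ} (τ : Equiv.Perm (Fin k)) :
    MeasurePreserving (fun z : Fin k → UnitSquare => z ∘ τ) (μ.sample k) (μ.sample k) := by
  refine ⟨measurable_pi_lambda _ fun i => measurable_pi_apply (τ i), ?_⟩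
  refine (Measure.pi_eq fun s hs => ?_).symm
  have hm : Measurable fun z : Fin k → UnitSquare => z ∘ τ :=
    measurable_pi_lambda _ fun i => measurable_pi_apply (τ i)
  rw [Measure.map_apply hm (MeasurableSet.univ_pi hs), ← Equiv.prod_comp τ⁻¹]
  have : (fun z : Fin k → UnitSquare => z ∘ τ) ⁻¹' Set.univ.pi s =
      Set.univ.pi fun i => s (τ⁻¹ i) := by
    ext z
    simp only [Set.mem_preimage, Set.mem_univ_pi, Function.comp_apply]
    exact ⟨fun h i => by simpa using h (τ⁻¹ i), fun h i => by simpa using h (τ i)⟩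
  rw [this, Measure.pi_pi]

theorem sample_real_orders_mul (μ : Permuton) {k : ℕ} (a b τ : Equiv.Perm (Fin k)) :
    (μ.sample k).real {z | orders z = (a * τ, b * τ)} =
      (μ.sample k).real {z | orders z = (a, b)} := by
  have hm : MeasurableSet {z : Fin k → UnitSquare | orders z = (a * τ, b * τ)} :=
    measurable_orders (measurableSet_singleton _)
  rw [measureReal_def, measureReal_def,
    ← (μ.measurePreserving_comp_perm τ).measure_preimage hm.nullMeasurableSet]
  congr 1
  refine measure_congr ?_
  filter_upwards [μ.ae_generic k] with z hz
  refine propext ?_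
  change orders (z ∘ τ) = (a * τ, b * τ) ↔ orders z = (a, b)
  have : orders (z ∘ τ) = ((orders z).1 * τ, (orders z).2 * τ) :=
    Prod.ext (relativeOrder_comp_perm hz.1 τ) (relativeOrder_comp_perm hz.2 τ)
  rw [this, Prod.ext_iff, Prod.ext_iff]
  simp

/-- Up to a null set, the event that the pattern is `b * a⁻¹` is the disjoint union over `τ` of the
events with orders `(a * τ, b * τ)`. By exchangeability these `k!` events are equally likely. -/
theorem sample_real_orders (μ : Permuton) {k : ℕ} (a b : Equiv.Perm (Fin k)) :
    (μ.sample k).real {z | orders z = (a, b)} =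
      (k.factorial : ℝ)⁻¹ * occDensity (b * a⁻¹) μ := by
  have hU : {z : Fin k → UnitSquare | permOfPoints z = b * a⁻¹} =ᵐ[μ.sample k]
      ⋃ τ : Equiv.Perm (Fin k), {z | orders z = (a * τ, b * τ)} := by
    filter_upwards [μ.ae_generic k] with z hz
    refine propext ?_
    change permOfPoints z = b * a⁻¹ ↔ z ∈ ⋃ τ : Equiv.Perm (Fin k), {z | orders z = (a * τ, b * τ)}
    simp only [Set.mem_iUnion, Set.mem_ofPred_eq, permOfPoints_eq hz]
    constructor
    · intro h
      refine ⟨a⁻¹ * (orders z).1, Prod.ext (by simp) ?_⟩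
      change (orders z).2 = b * (a⁻¹ * (orders z).1)
      rw [← mul_assoc, ← h, inv_mul_cancel_right]
    · rintro ⟨τ, hτ⟩
      simp [hτ, mul_assoc]
  rw [occDensity, measureReal_congr hU, measureReal_iUnion_fintype]
  · simp_rw [sample_real_orders_mul]
    rw [Finset.sum_const, Finset.card_univ, Fintype.card_perm, Fintype.card_fin, nsmul_eq_mul,
      inv_mul_cancel_left₀ (by positivity)]
  · intro τ τ' hne
    refine Set.disjoint_left.2 fun z h1 h2 => hne ?_
    have := (Prod.ext_iff.1 (h1.symm.trans h2)).1
    exact mul_left_cancel this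
  · exact fun τ => measurable_orders (measurableSet_singleton _)

/-- The probability of an event depending only on the relative orders of the coordinates is a
linear combination of pattern densities. -/
theorem sample_real_orders_mem (μ : Permuton) {k : ℕ}
    (A : Finset (Equiv.Perm (Fin k) × Equiv.Perm (Fin k))) :
    (μ.sample k).real {z | orders z ∈ A} =
      ∑ p ∈ A, (k.factorial : ℝ)⁻¹ * occDensity (p.2 * p.1⁻¹) μ := by
  have : {z : Fin k → UnitSquare | orders z ∈ A} = ⋃ p ∈ A, {z | orders z = p} := by
    ext z
    simp
  rw [this, measureReal_biUnion_finset]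
  · exact Finset.sum_congr rfl fun p _ => μ.sample_real_orders p.1 p.2
  · exact fun p _ q _ hpq => Set.disjoint_left.2 fun z h1 h2 => hpq (h1.symm.trans h2)
  · exact fun p _ => measurable_orders (measurableSet_singleton _)

/-! ## Pattern densities as continuous functions -/

theorem occDensity_nonneg {k : ℕ} (π : Equiv.Perm (Fin k)) (μ : Permuton) : 0 ≤ occDensity π μ :=
  measureReal_nonneg

theorem occDensity_le_one {k : ℕ} (π : Equiv.Perm (Fin k)) (μ : Permuton) : occDensity π μ ≤ 1 :=
  measureReal_le_one

theorem sum_occDensity {k : ℕ} (μ : Permuton) :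
    ∑ π : Equiv.Perm (Fin k), occDensity π μ = 1 := by
  simp only [occDensity]
  rw [← measureReal_iUnion_fintype]
  · have : (⋃ π : Equiv.Perm (Fin k), {z : Fin k → UnitSquare | permOfPoints z = π}) =
        Set.univ := by
      ext z
      simp
    rw [this]
    exact probReal_univ
  · exact fun p q hpq => Set.disjoint_left.2 fun z h1 h2 => hpq (h1.symm.trans h2)
  · exact fun p => measurable_permOfPoints (measurableSet_singleton _)

/-- Portmanteau: the product law depends continuously on `μ`, and the event has null frontier
because its frontier contains no generic point. -/
theorem continuous_occDensity {k : ℕ} (π : Equiv.Perm (Fin k)) :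
    Continuous fun μ : Permuton => occDensity π μ := by
  have hs : Continuous fun μ : Permuton => ProbabilityMeasure.pi fun _ : Fin k => μ.1 :=
    ProbabilityMeasure.continuous_pi.comp (continuous_pi fun _ => continuous_subtype_val)
  refine continuous_iff_continuousAt.2 fun μ => ?_
  have h0 : (μ.sample k) (frontier {z | permOfPoints z = π}) = 0 :=
    measure_mono_null (frontier_permOfPoints_subset π) (μ.ae_generic k)
  have := ProbabilityMeasure.tendsto_measure_of_null_frontier_of_tendsto'
    (hs.continuousAt (x := μ)) h0
  exact (ENNReal.tendsto_toReal (measure_ne_top _ _)).comp this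

/-- The pattern density as an element of the space of continuous functions. -/
def occMap (π : AllPerms) : C(Permuton, ℝ) := ⟨occDensity π.2, continuous_occDensity π.2⟩

end Permuton

/-- On a compact Polish space, a point-separating algebra of continuous functions determines
finite measures. -/
theorem MeasureTheory.ext_of_forall_mem_subalgebra_integral_eq_of_compactSpace {E : Type*}
    [TopologicalSpace E] [CompactSpace E] [PolishSpace E] [MeasurableSpace E] [BorelSpace E]
    {P P' : Measure E} [IsFiniteMeasure P] [IsFiniteMeasure P'] (A : Subalgebra ℝ C(E, ℝ))
    (hA : A.SeparatesPoints) (h : ∀ f ∈ A, ∫ x, f x ∂P = ∫ x, f x ∂P') : P = P' := by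
  -- On a compact space continuous functions are bounded, and the star is trivial over the reals, so
  -- `A` carries over to the bounded setting.
  let B : StarSubalgebra ℝ (BoundedContinuousFunction E ℝ) :=
    { A.comap (BoundedContinuousFunction.toContinuousMapₐ ℝ) with
      star_mem' := fun {f} hf => by
        have : star f = f := by
          ext x
          simp
        rwa [this] }
  refine ext_of_forall_mem_subalgebra_integral_eq_of_polish (𝕜 := ℝ) (A := B) ?_
    fun g hg => h _ hg
  intro x y hxy
  obtain ⟨_, ⟨f, hf, rfl⟩, hne⟩ := hA hxy
  exact ⟨_, ⟨f, ⟨BoundedContinuousFunction.mkOfCompact f, hf, rfl⟩, rfl⟩, hne⟩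

namespace Permuton

/-! ## The algebra spanned by pattern densities -/

/-- The linear span of the pattern densities. -/
def patternSpan : Submodule ℝ C(Permuton, ℝ) := Submodule.span ℝ (Set.range occMap)

theorem mem_patternSpan_of_orders {k : ℕ} (hk : 0 < k)
    (A : Finset (Equiv.Perm (Fin k) × Equiv.Perm (Fin k))) {f : C(Permuton, ℝ)}
    (hf : ∀ μ : Permuton, f μ = (μ.sample k).real {z | orders z ∈ A}) : f ∈ patternSpan := by
  have : f = ∑ p ∈ A, (k.factorial : ℝ)⁻¹ • occMap ⟨⟨k, hk⟩, p.2 * p.1⁻¹⟩ := by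
    ext μ
    rw [hf, sample_real_orders_mem]
    simp [occMap]
  rw [this]
  exact Submodule.sum_mem _ fun p _ => Submodule.smul_mem _ _ (Submodule.subset_span ⟨_, rfl⟩)

theorem map_append_sample (μ : Permuton) (k l : ℕ) :
    ((μ.sample k).prod (μ.sample l)).map (fun p => Fin.append p.1 p.2) = μ.sample (k + l) := by
  have hm : Measurable fun p : (Fin k → UnitSquare) × (Fin l → UnitSquare) =>
      Fin.append p.1 p.2 := by
    refine measurable_pi_lambda _ fun i => ?_
    refine Fin.addCases (fun i => ?_) (fun i => ?_) i
    · simp only [Fin.append_left]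
      fun_prop
    · simp only [Fin.append_right]
      fun_prop
  refine (Measure.pi_eq fun s hs => ?_).symm
  rw [Measure.map_apply hm (MeasurableSet.univ_pi hs), Fin.prod_univ_add]
  have : (fun p : (Fin k → UnitSquare) × (Fin l → UnitSquare) => Fin.append p.1 p.2) ⁻¹'
      Set.univ.pi s = (Set.univ.pi fun i => s (Fin.castAdd l i)) ×ˢ
        (Set.univ.pi fun i => s (Fin.natAdd k i)) := by
    ext p
    simp only [Set.mem_preimage, Set.mem_univ_pi, Set.mem_prod]
    refine ⟨fun h => ⟨fun i => by simpa using h (Fin.castAdd l i),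
      fun i => by simpa using h (Fin.natAdd k i)⟩, fun h i => ?_⟩
    refine Fin.addCases (fun i => ?_) (fun i => ?_) i
    · simpa using h.1 i
    · simpa using h.2 i
  rw [this, Measure.prod_prod, Measure.pi_pi, Measure.pi_pi]

/-- The pattern formed by some of the points is determined by the relative orders of all of
them. -/
theorem permOfPoints_comp {k m : ℕ} {z : Fin k → UnitSquare} (hz : z ∈ generic k)
    {e : Fin m → Fin k} (he : Function.Injective e) :
    permOfPoints (z ∘ e) =
      relativeOrder ((orders z).2 ∘ e) * (relativeOrder ((orders z).1 ∘ e))⁻¹ := by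
  have hze : z ∘ e ∈ generic m := ⟨hz.1.comp he, hz.2.comp he⟩
  rw [permOfPoints_eq hze]
  have h1 := relativeOrder_comp_relativeOrder hz.1 he
  have h2 := relativeOrder_comp_relativeOrder hz.2 he
  exact congrArg₂ (fun a b => a * b⁻¹) h2 h1

/-- The product is the probability that, among `k + l` independent points, the first `k` induce `π`
and the last `l` induce `ρ`. Almost surely this is decided by the relative orders of all the points.
-/
theorem occMap_mul_occMap_mem (π ρ : AllPerms) : occMap π * occMap ρ ∈ patternSpan := by
  classical
  obtain ⟨k, π⟩ := π
  obtain ⟨l, ρ⟩ := ρ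
  have he : Function.Injective (Fin.castAdd l : Fin k → Fin (k + l)) :=
    Fin.castAdd_injective _ _
  have he' : Function.Injective (Fin.natAdd k : Fin l → Fin (k + l)) := Fin.natAdd_injective _ _
  refine mem_patternSpan_of_orders (k := (k : ℕ) + l) (by positivity)
    (Finset.univ.filter fun p =>
      relativeOrder (p.2 ∘ Fin.castAdd l) * (relativeOrder (p.1 ∘ Fin.castAdd l))⁻¹ = π ∧
      relativeOrder (p.2 ∘ Fin.natAdd k) * (relativeOrder (p.1 ∘ Fin.natAdd k))⁻¹ = ρ)
    fun μ => ?_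
  have hae : {z : Fin (k + l) → UnitSquare | orders z ∈ Finset.univ.filter fun p =>
      relativeOrder (p.2 ∘ Fin.castAdd l) * (relativeOrder (p.1 ∘ Fin.castAdd l))⁻¹ = π ∧
      relativeOrder (p.2 ∘ Fin.natAdd k) * (relativeOrder (p.1 ∘ Fin.natAdd k))⁻¹ = ρ}
      =ᵐ[μ.sample (k + l)]
      {z : Fin (k + l) → UnitSquare | permOfPoints (z ∘ Fin.castAdd l) = π ∧
        permOfPoints (z ∘ Fin.natAdd k) = ρ} := by
    filter_upwards [μ.ae_generic (k + l)] with z hz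
    refine propext ?_
    change orders z ∈ _ ↔ permOfPoints (z ∘ Fin.castAdd l) = π ∧
        permOfPoints (z ∘ Fin.natAdd k) = ρ
    rw [permOfPoints_comp hz he, permOfPoints_comp hz he']
    simp
  have hm : ∀ {m : ℕ} (π : Equiv.Perm (Fin m)),
      MeasurableSet {z : Fin m → UnitSquare | permOfPoints z = π} := fun π =>
    measurable_permOfPoints (measurableSet_singleton _)
  rw [measureReal_congr hae, measureReal_def, ← map_append_sample, Measure.map_apply]
  · have : (fun p : (Fin k → UnitSquare) × (Fin l → UnitSquare) => Fin.append p.1 p.2) ⁻¹'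
        {z | permOfPoints (z ∘ Fin.castAdd l) = π ∧ permOfPoints (z ∘ Fin.natAdd k) = ρ} =
        {z | permOfPoints z = π} ×ˢ {z | permOfPoints z = ρ} := by
      ext p
      simp only [Set.mem_preimage, Set.mem_ofPred_eq, Set.mem_prod]
      have h1 : Fin.append p.1 p.2 ∘ Fin.castAdd l = p.1 := by ext1; simp
      have h2 : Fin.append p.1 p.2 ∘ Fin.natAdd k = p.2 := by ext1; simp
      rw [h1, h2]
    rw [this, Measure.prod_prod, ENNReal.toReal_mul]
    rfl
  · refine measurable_pi_lambda _ fun i => ?_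
    refine Fin.addCases (fun i => ?_) (fun i => ?_) i
    · simp only [Fin.append_left]
      fun_prop
    · simp only [Fin.append_right]
      fun_prop
  · have h1 : Measurable fun z : Fin (k + l) → UnitSquare => z ∘ Fin.castAdd l :=
      measurable_pi_lambda _ fun i => measurable_pi_apply _
    have h2 : Measurable fun z : Fin (k + l) → UnitSquare => z ∘ Fin.natAdd k :=
      measurable_pi_lambda _ fun i => measurable_pi_apply _
    exact (h1 (hm π)).inter (h2 (hm ρ))

theorem one_mem_patternSpan : (1 : C(Permuton, ℝ)) ∈ patternSpan := by
  -- A single point suffices: the event is certain, and the size must be positive.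
  refine mem_patternSpan_of_orders one_pos Finset.univ fun μ => ?_
  simp

/-- The algebra of linear combinations of pattern densities. -/
def patternAlgebra : Subalgebra ℝ C(Permuton, ℝ) :=
  patternSpan.toSubalgebra one_mem_patternSpan fun f g hf hg => by
    have : patternSpan * patternSpan ≤ patternSpan := by
      rw [patternSpan, Submodule.span_mul_span, Submodule.span_le]
      rintro _ ⟨_, ⟨π, rfl⟩, _, ⟨ρ, rfl⟩, rfl⟩
      exact occMap_mul_occMap_mem π ρ
    exact this (Submodule.mul_mem_mul hf hg)

/-! ## Pattern densities determine permutons -/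

theorem map_cons_sample (μ : Permuton) (m : ℕ) :
    (μ.toMeasure.prod (μ.sample m)).map
      (fun p => (Fin.cons p.1 p.2 : Fin (m + 1) → UnitSquare)) = μ.sample (m + 1) := by
  have hm : Measurable fun p : UnitSquare × (Fin m → UnitSquare) =>
      (Fin.cons p.1 p.2 : Fin (m + 1) → UnitSquare) := by
    refine measurable_pi_lambda _ fun i => ?_
    refine Fin.cases ?_ (fun i => ?_) i
    · simp only [Fin.cons_zero]
      fun_prop
    · simp only [Fin.cons_succ]
      fun_prop
  refine (Measure.pi_eq fun s hs => ?_).symm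
  rw [Measure.map_apply hm (MeasurableSet.univ_pi hs), Fin.prod_univ_succ]
  have : (fun p : UnitSquare × (Fin m → UnitSquare) =>
      (Fin.cons p.1 p.2 : Fin (m + 1) → UnitSquare)) ⁻¹' Set.univ.pi s =
      s 0 ×ˢ (Set.univ.pi fun i => s i.succ) := by
    ext p
    simp [Fin.forall_fin_succ]
  rw [this, Measure.prod_prod, Measure.pi_pi]

/-- The moments of a permuton are probabilities of events depending only on relative orders. -/
theorem sample_forall_le (μ : Permuton) {m : ℕ} (c : Fin m → UnitSquare → unitInterval)
    (hc : ∀ i, Measurable (c i)) (hμ : ∀ i, μ.toMeasure.map (c i) = volume) :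
    (μ.sample (m + 1)).real {z | ∀ i, c i (z i.succ) ≤ c i (z 0)} =
      ∫ z, ∏ i, (c i z : ℝ) ∂μ.toMeasure := by
  have hS : MeasurableSet {p : UnitSquare × (Fin m → UnitSquare) |
      ∀ i, c i (p.2 i) ≤ c i p.1} := by
    simp only [Set.ofPred_forall]
    exact MeasurableSet.iInter fun i => measurableSet_le
      ((hc i).comp ((measurable_pi_apply i).comp measurable_snd)) ((hc i).comp measurable_fst)
  have hS' : MeasurableSet {z : Fin (m + 1) → UnitSquare | ∀ i, c i (z i.succ) ≤ c i (z 0)} := by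
    simp only [Set.ofPred_forall]
    exact MeasurableSet.iInter fun i => measurableSet_le
      ((hc i).comp (measurable_pi_apply _)) ((hc i).comp (measurable_pi_apply _))
  have hm : Measurable fun p : UnitSquare × (Fin m → UnitSquare) =>
      (Fin.cons p.1 p.2 : Fin (m + 1) → UnitSquare) := by
    refine measurable_pi_lambda _ fun i => ?_
    refine Fin.cases ?_ (fun i => ?_) i
    · simp only [Fin.cons_zero]
      fun_prop
    · simp only [Fin.cons_succ]
      fun_prop
  have hpre : (fun p : UnitSquare × (Fin m → UnitSquare) =>
      (Fin.cons p.1 p.2 : Fin (m + 1) → UnitSquare)) ⁻¹'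
      {z | ∀ i, c i (z i.succ) ≤ c i (z 0)} = {p | ∀ i, c i (p.2 i) ≤ c i p.1} := by
    ext p
    simp
  have hpos : ∀ z, 0 ≤ ∏ i, (c i z : ℝ) := fun z => Finset.prod_nonneg fun i _ => (c i z).2.1
  have hmeas : Measurable fun z => ∏ i, (c i z : ℝ) :=
    Finset.measurable_prod _ fun i _ => measurable_subtype_coe.comp (hc i)
  rw [measureReal_def, ← map_cons_sample, Measure.map_apply hm hS', hpre,
    Measure.prod_apply hS, integral_eq_lintegral_of_nonneg_ae (ae_of_all _ hpos)
      hmeas.aestronglyMeasurable]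
  congr 1
  refine lintegral_congr fun z => ?_
  -- Once the reference point `z` is fixed, the other points give independent uniform coordinates,
  -- and a uniform variable is at most `t` with probability `t`.
  have hbox : Prod.mk z ⁻¹' {p : UnitSquare × (Fin m → UnitSquare) |
      ∀ i, c i (p.2 i) ≤ c i p.1} = Set.univ.pi fun i => c i ⁻¹' Set.Iic (c i z) := by
    ext w
    simp
  rw [hbox, Measure.pi_pi, ENNReal.ofReal_prod_of_nonneg fun i _ => (c i z).2.1]
  refine Finset.prod_congr rfl fun i _ => ?_
  rw [← Measure.map_apply (hc i) measurableSet_Iic, hμ, unitInterval.volume_Iic]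

/-- Letting each `c i` be either coordinate produces all mixed moments. Point `0` is the reference,
and each further point is compared with it in one coordinate only, so almost surely the event reads
off the orders. -/
theorem integral_eq_of_occDensity_eq {μ ν : Permuton}
    (h : ∀ π : AllPerms, occDensity π.2 μ = occDensity π.2 ν) {m : ℕ}
    (c : Fin m → UnitSquare → unitInterval) (hc : ∀ i, c i = Prod.fst ∨ c i = Prod.snd) :
    ∫ z, ∏ i, (c i z : ℝ) ∂μ.toMeasure = ∫ z, ∏ i, (c i z : ℝ) ∂ν.toMeasure := by
  classical
  have hcm : ∀ i, Measurable (c i) := fun i => by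
    rcases hc i with h | h <;> rw [h]
    exacts [measurable_fst, measurable_snd]
  have hl : ∀ (ρ : Permuton) (i : Fin m), ρ.toMeasure.map (c i) = volume := fun ρ i => by
    rcases hc i with h | h <;> rw [h]
    exacts [ρ.map_fst_toMeasure, ρ.map_snd_toMeasure]
  let A : Finset (Equiv.Perm (Fin (m + 1)) × Equiv.Perm (Fin (m + 1))) :=
    Finset.univ.filter fun p => ∀ i : Fin m, (c i = Prod.fst → p.1 i.succ ≤ p.1 0) ∧
      (c i = Prod.snd → p.2 i.succ ≤ p.2 0)
  have hA : ∀ ρ : Permuton, (ρ.sample (m + 1)).real {z | ∀ i, c i (z i.succ) ≤ c i (z 0)} =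
      (ρ.sample (m + 1)).real {z | orders z ∈ A} := by
    intro ρ
    refine measureReal_congr ?_
    filter_upwards [ρ.ae_generic (m + 1)] with z hz
    refine propext ?_
    change (∀ i, c i (z i.succ) ≤ c i (z 0)) ↔ orders z ∈ A
    simp only [A, Finset.mem_filter, Finset.mem_univ, true_and]
    refine forall_congr' fun i => ?_
    have h1 := relativeOrder_le_iff hz.1 i.succ 0
    have h2 := relativeOrder_le_iff hz.2 i.succ 0
    have h3 : (Prod.fst : UnitSquare → unitInterval) ≠ Prod.snd := fun h =>
      zero_ne_one (congrFun h ((0, 1) : UnitSquare))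
    rcases hc i with h | h
    · simp [h, h3, orders, h1]
    · simp [h, h3.symm, orders, h2]
  rw [← sample_forall_le μ c hcm (hl μ), ← sample_forall_le ν c hcm (hl ν), hA, hA,
    sample_real_orders_mem, sample_real_orders_mem]
  refine Finset.sum_congr rfl fun p _ => ?_
  exact congrArg _ (h ⟨⟨m + 1, m.succ_pos⟩, p.2 * p.1⁻¹⟩)

/-- Polynomials in the two coordinates separate points of the square, so a permuton is determined by
its mixed moments. -/
theorem eq_of_occDensity_eq {μ ν : Permuton}
    (h : ∀ π : AllPerms, occDensity π.2 μ = occDensity π.2 ν) : μ = ν := by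
  let X : C(UnitSquare, ℝ) := ⟨fun z => z.1, by fun_prop⟩
  let Y : C(UnitSquare, ℝ) := ⟨fun z => z.2, by fun_prop⟩
  refine ext_toMeasure
    (ext_of_forall_mem_subalgebra_integral_eq_of_compactSpace (Algebra.adjoin ℝ {X, Y}) ?_ ?_)
  · intro z w hzw
    by_cases h1 : z.1 = w.1
    · refine ⟨_, ⟨Y, Algebra.subset_adjoin (by simp), rfl⟩, fun h2 => hzw ?_⟩
      exact Prod.ext h1 (Subtype.ext h2)
    · exact ⟨_, ⟨X, Algebra.subset_adjoin (by simp), rfl⟩, fun h2 => h1 (Subtype.ext h2)⟩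
  · intro f hf
    rw [← Subalgebra.mem_toSubmodule, Algebra.adjoin_eq_span] at hf
    have hint : ∀ (ρ : Permuton) (f : C(UnitSquare, ℝ)), Integrable f ρ.toMeasure := fun ρ f =>
      f.continuous.integrable_of_hasCompactSupport (HasCompactSupport.of_compactSpace f)
    induction hf using Submodule.span_induction with
    | zero => simp
    | add f g _ _ hf hg =>
      simp only [ContinuousMap.add_apply]
      rw [integral_add (hint μ f) (hint μ g), integral_add (hint ν f) (hint ν g), hf, hg]
    | smul a f _ hf =>
      simp only [ContinuousMap.smul_apply]
      rw [integral_smul, integral_smul, hf]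
    | mem f hf =>
      -- A monomial is a word in the letters `X` and `Y`, and its letters supply the functions `c
      -- i`.
      obtain ⟨l, hl, rfl⟩ := Submonoid.exists_list_of_mem_closure hf
      have hc : ∀ i : Fin l.length, ∃ c : UnitSquare → unitInterval,
          (c = Prod.fst ∨ c = Prod.snd) ∧ ∀ z, l[i] z = c z := by
        intro i
        rcases hl _ (List.getElem_mem i.2) with h | h
        · exact ⟨Prod.fst, Or.inl rfl, fun z => by simp [h, X]⟩
        · exact ⟨Prod.snd, Or.inr rfl, fun z => by simp [Set.mem_singleton_iff.1 h, Y]⟩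
      choose c hc hlc using hc
      have hprod : ∀ z, l.prod z = ∏ i, (c i z : ℝ) := by
        intro z
        conv_lhs => rw [← List.ofFn_getElem (xs := l), List.prod_ofFn]
        rw [ContinuousMap.prod_apply]
        exact Finset.prod_congr rfl fun i _ => hlc i z
      simp only [hprod]
      exact integral_eq_of_occDensity_eq h c hc

theorem separatesPoints_patternAlgebra : patternAlgebra.SeparatesPoints := by
  intro μ ν hne
  by_contra! hcon
  refine hne (eq_of_occDensity_eq fun π => ?_)
  exact hcon _ ⟨occMap π, Submodule.subset_span ⟨π, rfl⟩, rfl⟩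

/-- The law of a random permuton is determined by its expected pattern densities. -/
theorem measure_eq_of_integral_occDensity_eq {Q Q' : Measure Permuton} [IsProbabilityMeasure Q]
    [IsProbabilityMeasure Q']
    (h : ∀ π : AllPerms, ∫ μ, occDensity π.2 μ ∂Q = ∫ μ, occDensity π.2 μ ∂Q') : Q = Q' := by
  have hint : ∀ (Q : Measure Permuton) [IsProbabilityMeasure Q] (f : C(Permuton, ℝ)),
      Integrable f Q := fun Q _ f =>
    f.continuous.integrable_of_hasCompactSupport (HasCompactSupport.of_compactSpace f)
  refine ext_of_forall_mem_subalgebra_integral_eq_of_compactSpace patternAlgebra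
    separatesPoints_patternAlgebra fun f hf => ?_
  change f ∈ patternSpan at hf
  rw [patternSpan] at hf
  induction hf using Submodule.span_induction with
  | zero => simp
  | add f g _ _ hf hg =>
    simp only [ContinuousMap.add_apply]
    rw [integral_add (hint Q f) (hint Q g), integral_add (hint Q' f) (hint Q' g), hf, hg]
  | smul a f _ hf =>
    simp only [ContinuousMap.smul_apply]
    rw [integral_smul, integral_smul, hf]
  | mem f hf =>
    obtain ⟨π, rfl⟩ := hf
    exact h π

end Permuton

/-! ## Pattern densities in permutations -/

theorem occDensity_nonneg {n k : ℕ} (π : Equiv.Perm (Fin k)) (σ : Equiv.Perm (Fin n)) :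
    0 ≤ occDensity π σ := by
  unfold occDensity
  positivity

theorem natCard_powersetCard (n k : ℕ) : Nat.card (Set.powersetCard (Fin n) k) = n.choose k := by
  rw [Set.powersetCard.card, Nat.card_fin]

theorem sum_occCount {n : ℕ} (k : ℕ) (σ : Equiv.Perm (Fin n)) :
    ∑ π : Equiv.Perm (Fin k), occCount π σ = n.choose k := by
  rw [← natCard_powersetCard, ← Nat.card_congr
    (Equiv.sigmaFiberEquiv fun I : Set.powersetCard (Fin n) k => inducedPattern σ I),
    Nat.card_sigma]
  rfl

theorem sum_occDensity {n k : ℕ} (h : k ≤ n) (σ : Equiv.Perm (Fin n)) :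
    ∑ π : Equiv.Perm (Fin k), occDensity π σ = 1 := by
  have h0 : (n.choose k : ℝ) ≠ 0 := by exact_mod_cast (Nat.choose_pos h).ne'
  simp only [occDensity]
  rw [← Finset.sum_div, ← Nat.cast_sum, sum_occCount, div_self h0]

theorem occDensity_le_one {n k : ℕ} (π : Equiv.Perm (Fin k)) (σ : Equiv.Perm (Fin n)) :
    occDensity π σ ≤ 1 := by
  unfold occDensity
  refine div_le_one_of_le₀ ?_ (by positivity)
  rw [← sum_occCount k σ]
  exact_mod_cast Finset.single_le_sum (f := fun π => occCount π σ)
    (fun _ _ => Nat.zero_le _) (Finset.mem_univ π)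

/-! ### Comparison of a permutation with its diagram permuton. -/

namespace Permuton

theorem lt_of_mem_cell {n : ℕ} {i j : Fin n} {x y : unitInterval} (hx : x ∈ cell n i)
    (hy : y ∈ cell n j) (hij : i < j) : x < y := by
  by_contra! h
  simp only [cell, Set.mem_ofPred_eq] at hx hy
  have : ⌈(y : ℝ) * n⌉₊ ≤ ⌈(x : ℝ) * n⌉₊ := by
    have : (y : ℝ) ≤ x := h
    gcongr
  have : (i : ℕ) < j := hij
  omega

theorem toMeasure_ofPerm_cell {n : ℕ+} (σ : Equiv.Perm (Fin n)) (i : Fin n) :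
    (ofPerm σ).toMeasure (cell n i ×ˢ cell n (σ i)) = ((n : ℕ) : ENNReal)⁻¹ := by
  have hm : MeasurableSet (cell n i ×ˢ cell n (σ i)) :=
    (measurableSet_cell n i).prod (measurableSet_cell n (σ i))
  have hd : Set.EqOn (diagramDensity σ) (fun _ => ((n : ℕ) : ENNReal))
      (cell n i ×ˢ cell n (σ i)) := fun z hz => if_pos ⟨i, hz.1, hz.2⟩
  change diagramMeasure σ _ = _
  rw [diagramMeasure, withDensity_apply _ hm, setLIntegral_congr_fun hm hd, setLIntegral_const]
  have h1 := volume_cell (n := n) i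
  have h2 := volume_cell (n := n) (σ i)
  have : (volume : Measure UnitSquare) (cell n i ×ˢ cell n (σ i)) =
      volume (cell n i) * volume (cell n (σ i)) := Measure.prod_prod _ _
  rw [this, ← mul_assoc, h1, one_mul]
  exact ENNReal.eq_inv_of_mul_eq_one_left (by rwa [mul_comm])

/-- Points falling in distinct cells of the diagram of `σ` induce the pattern of `σ` at the
corresponding positions. -/
theorem permOfPoints_eq_inducedPattern {n k : ℕ} (σ : Equiv.Perm (Fin n))
    (I : Set.powersetCard (Fin n) k) (τ : Equiv.Perm (Fin k)) {z : Fin k → UnitSquare}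
    (hz : ∀ j, z j ∈ cell n ((I : Finset (Fin n)).orderEmbOfFin I.2 (τ j)) ×ˢ
      cell n (σ ((I : Finset (Fin n)).orderEmbOfFin I.2 (τ j)))) :
    permOfPoints z = inducedPattern σ I := by
  set e := (I : Finset (Fin n)).orderEmbOfFin I.2 with he
  have hx : ∀ i j, τ i < τ j → (z i).1 < (z j).1 := fun i j hij =>
    lt_of_mem_cell (hz i).1 (hz j).1 (e.strictMono hij)
  have hσ : Function.Injective fun j => σ (e j) := σ.injective.comp e.injective
  have hy : ∀ i j, (inducedPattern σ I * τ) i < (inducedPattern σ I * τ) j →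
      (z i).2 < (z j).2 := fun i j hij =>
    lt_of_mem_cell (hz i).2 (hz j).2 ((relativeOrder_lt_iff hσ _ _).1 hij)
  obtain ⟨hx1, hx2⟩ := eq_relativeOrder hx
  obtain ⟨hy1, hy2⟩ := eq_relativeOrder hy
  rw [permOfPoints_eq ⟨hx1, hy1⟩, orders, hx2, hy2, mul_inv_cancel_right]

/-- An occurrence of `π` together with a labelling of its positions prescribes a cell for each of
the `k` points, an event of probability `n⁻ᵏ` on which the pattern is `π`. Distinct data give
disjoint events. -/
theorem le_occDensity_ofPerm {n : ℕ+} {k : ℕ} (π : Equiv.Perm (Fin k)) (σ : Equiv.Perm (Fin n)) :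
    ((k.factorial * occCount π σ : ℕ) : ℝ) / (n : ℝ) ^ k ≤ occDensity π (ofPerm σ) := by
  classical
  -- The range of `f t` recovers the set of positions, after which the values recover the labelling.
  let T := {I : Set.powersetCard (Fin n) k // inducedPattern σ I = π} × Equiv.Perm (Fin k)
  let f : T → Fin k → Fin n := fun t j => (t.1.1 : Finset (Fin n)).orderEmbOfFin t.1.1.2 (t.2 j)
  have hf : Function.Injective f := by
    rintro ⟨⟨I, hI⟩, τ⟩ ⟨⟨J, hJ⟩, ρ⟩ h
    have hr : ∀ (t : T), Set.range (f t) = (t.1.1 : Finset (Fin n)) := fun t => by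
      exact (t.2.surjective.range_comp _).trans (Finset.range_orderEmbOfFin _ _)
    have hIJ : I = J := by
      have := (hr ⟨⟨I, hI⟩, τ⟩).symm.trans ((congrArg Set.range h).trans (hr ⟨⟨J, hJ⟩, ρ⟩))
      exact Subtype.ext (Finset.coe_injective this)
    subst hIJ
    have : τ = ρ := by
      ext1 j
      exact (Finset.orderEmbOfFin _ _).injective (congrFun h j)
    rw [this]
  let B : T → Set (Fin k → UnitSquare) := fun t =>
    Set.univ.pi fun j => cell n (f t j) ×ˢ cell n (σ (f t j))
  have hB : ∀ t, ((ofPerm σ).sample k).real (B t) = ((n : ℝ) ^ k)⁻¹ := fun t => by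
    rw [measureReal_def, Measure.pi_pi]
    simp only [toMeasure_ofPerm_cell]
    simp
  have hd : Pairwise (Function.onFun Disjoint B) := by
    intro t t' hne
    obtain ⟨j, hj⟩ := Function.ne_iff.1 (hf.ne hne)
    refine Set.disjoint_left.2 fun z h1 h2 => ?_
    exact Set.disjoint_left.1 (pairwise_disjoint_cell n hj) (h1 j trivial).1 (h2 j trivial).1
  have hs : (⋃ t, B t) ⊆ {z | permOfPoints z = π} := by
    refine Set.iUnion_subset fun t z hz => ?_
    exact (permOfPoints_eq_inducedPattern σ t.1.1 t.2 fun j => hz j trivial).trans t.1.2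
  refine le_trans (le_of_eq ?_) (measureReal_mono hs)
  rw [measureReal_iUnion_fintype hd fun t => MeasurableSet.univ_pi fun j =>
    (measurableSet_cell n _).prod (measurableSet_cell n _)]
  simp only [hB]
  rw [Finset.sum_const, Finset.card_univ, nsmul_eq_mul, ← Nat.card_eq_fintype_card,
    Nat.card_prod, Nat.card_eq_fintype_card (α := Equiv.Perm (Fin k)), Fintype.card_perm,
    Fintype.card_fin, mul_comm k.factorial, div_eq_mul_inv]
  rfl

/-- The pattern densities of `σ` and of the associated permuton are close. -/
theorem abs_occDensity_sub_le {n : ℕ+} {k : ℕ} (h : k ≤ n) (π : Equiv.Perm (Fin k))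
    (σ : Equiv.Perm (Fin n)) :
    |_root_.occDensity π σ - occDensity π (ofPerm σ)| ≤
      1 - (Nat.descFactorial n k : ℝ) / (n : ℝ) ^ k := by
  classical
  -- The probability that `k` independent uniform choices among `n` cells are distinct.
  set p : ℝ := (Nat.descFactorial n k : ℝ) / (n : ℝ) ^ k with hp
  have hp0 : 0 ≤ p := by positivity
  have hlow : ∀ π : Equiv.Perm (Fin k), p * _root_.occDensity π σ ≤ occDensity π (ofPerm σ) := by
    intro π
    refine le_trans (le_of_eq ?_) (le_occDensity_ofPerm π σ)
    have h0 : ((n : ℕ).choose k : ℝ) ≠ 0 := by exact_mod_cast (Nat.choose_pos h).ne'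
    rw [hp, _root_.occDensity, Nat.descFactorial_eq_factorial_mul_choose]
    push_cast
    field_simp
  have h1 := _root_.sum_occDensity h σ
  have h2 := sum_occDensity (k := k) (ofPerm σ)
  -- The upper bound comes from total mass: the nonnegative differences sum over all patterns to `1
  -- - p`, so each is at most `1 - p`.
  have h3 : ∀ π : Equiv.Perm (Fin k),
      occDensity π (ofPerm σ) - p * _root_.occDensity π σ ≤ 1 - p := by
    intro π
    refine (Finset.single_le_sum (f := fun π : Equiv.Perm (Fin k) =>
      occDensity π (ofPerm σ) - p * _root_.occDensity π σ)
      (fun π _ => sub_nonneg.2 (hlow π)) (Finset.mem_univ π)).trans ?_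
    rw [Finset.sum_sub_distrib, ← Finset.mul_sum, h1, h2, mul_one]
  have hp1 : 0 ≤ 1 - p := (sub_nonneg.2 (hlow π)).trans (h3 π)
  have h4 := h3 π
  have h5 := hlow π
  have h6 := _root_.occDensity_nonneg π σ
  have h7 := _root_.occDensity_le_one π σ
  rw [abs_le]
  constructor <;> nlinarith

theorem tendsto_descFactorial_div_pow (k : ℕ) :
    Tendsto (fun n : ℕ => (n.descFactorial k : ℝ) / (n : ℝ) ^ k) atTop (𝓝 1) := by
  refine (Asymptotics.isEquivalent_iff_tendsto_one ?_).1 (isEquivalent_descFactorial k)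
  filter_upwards [eventually_gt_atTop 0] with n hn
  positivity

end Permuton

/-! ## Convergence in distribution through test functions -/

namespace MeasureTheory

theorem tendstoInDistribution_iff_forall_integral_tendsto {ι E Ω' : Type*} {Ω : ι → Type*}
    {m : ∀ i, MeasurableSpace (Ω i)} {P : ∀ i, Measure (Ω i)} [∀ i, IsProbabilityMeasure (P i)]
    {m' : MeasurableSpace Ω'} {P' : Measure Ω'} [IsProbabilityMeasure P']
    [MeasurableSpace E] [TopologicalSpace E] [OpensMeasurableSpace E]
    {X : ∀ i, Ω i → E} {Z : Ω' → E} {l : Filter ι}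
    (hX : ∀ i, AEMeasurable (X i) (P i)) (hZ : AEMeasurable Z P') :
    TendstoInDistribution X l Z P P' ↔ ∀ f : BoundedContinuousFunction E ℝ,
      Tendsto (fun i => ∫ ω, f (X i ω) ∂(P i)) l (𝓝 (∫ ω, f (Z ω) ∂P')) := by
  have h1 : ∀ (f : BoundedContinuousFunction E ℝ) (i : ι),
      ∫ x, f x ∂((P i).map (X i)) = ∫ ω, f (X i ω) ∂(P i) := fun f i =>
    integral_map (hX i) f.continuous.measurable.aestronglyMeasurable
  have h2 : ∀ f : BoundedContinuousFunction E ℝ,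
      ∫ x, f x ∂(P'.map Z) = ∫ ω, f (Z ω) ∂P' := fun f =>
    integral_map hZ f.continuous.measurable.aestronglyMeasurable
  constructor
  · intro h f
    have := ProbabilityMeasure.tendsto_iff_forall_integral_tendsto.1 h.tendsto f
    simpa only [ProbabilityMeasure.coe_mk, h1, h2] using this
  · intro h
    refine ⟨hX, hZ, ProbabilityMeasure.tendsto_iff_forall_integral_tendsto.2 fun f => ?_⟩
    simpa only [ProbabilityMeasure.coe_mk, h1, h2] using h f

theorem TendstoInDistribution.tendsto_integral {ι E Ω' : Type*} {Ω : ι → Type*}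
    {m : ∀ i, MeasurableSpace (Ω i)} {P : ∀ i, Measure (Ω i)} [∀ i, IsProbabilityMeasure (P i)]
    {m' : MeasurableSpace Ω'} {P' : Measure Ω'} [IsProbabilityMeasure P']
    [MeasurableSpace E] [TopologicalSpace E] [OpensMeasurableSpace E]
    {X : ∀ i, Ω i → E} {Z : Ω' → E} {l : Filter ι} (h : TendstoInDistribution X l Z P P')
    (f : BoundedContinuousFunction E ℝ) :
    Tendsto (fun i => ∫ ω, f (X i ω) ∂(P i)) l (𝓝 (∫ ω, f (Z ω) ∂P')) :=
  (tendstoInDistribution_iff_forall_integral_tendsto h.forall_aemeasurable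
    h.aemeasurable_limit).1 h f

theorem integral_comp_eq_sum_of_finite {E Ω : Type*} [MeasurableSpace Ω] {P : Measure Ω}
    [IsFiniteMeasure P] [MeasurableSpace E] [MeasurableSingletonClass E] [Fintype E]
    {X : Ω → E} (hX : AEMeasurable X P) (f : E → ℝ) :
    ∫ ω, f (X ω) ∂P = ∑ e, P.real {ω | X ω = e} * f e := by
  rw [← integral_map (f := f) hX Measurable.of_discrete.aestronglyMeasurable,
    integral_fintype .of_finite]
  refine Finset.sum_congr rfl fun e _ => ?_
  rw [map_measureReal_apply_of_aemeasurable hX (measurableSet_singleton e)]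
  rfl

/-- For random elements of a finite discrete space, convergence in distribution is convergence of
the probabilities of the points. -/
theorem tendstoInDistribution_iff_of_finite {ι E Ω' : Type*} {Ω : ι → Type*}
    {m : ∀ i, MeasurableSpace (Ω i)} {P : ∀ i, Measure (Ω i)} [∀ i, IsProbabilityMeasure (P i)]
    {m' : MeasurableSpace Ω'} {P' : Measure Ω'} [IsProbabilityMeasure P']
    [MeasurableSpace E] [TopologicalSpace E] [DiscreteTopology E] [OpensMeasurableSpace E]
    [MeasurableSingletonClass E] [Finite E]
    {X : ∀ i, Ω i → E} {Z : Ω' → E} {l : Filter ι}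
    (hX : ∀ i, AEMeasurable (X i) (P i)) (hZ : AEMeasurable Z P') :
    TendstoInDistribution X l Z P P' ↔ ∀ e : E,
      Tendsto (fun i => (P i).real {ω | X i ω = e}) l (𝓝 (P'.real {ω | Z ω = e})) := by
  classical
  have := Fintype.ofFinite E
  rw [tendstoInDistribution_iff_forall_integral_tendsto hX hZ]
  constructor
  · intro h e
    have := h (BoundedContinuousFunction.mkOfCompact ⟨Pi.single e 1, continuous_of_discreteTopology⟩)
    simp only [BoundedContinuousFunction.mkOfCompact_apply, ContinuousMap.coe_mk] at this
    simp only [integral_comp_eq_sum_of_finite (hX _), integral_comp_eq_sum_of_finite hZ] at this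
    simpa only [Pi.single_apply, mul_ite, mul_one, mul_zero,
      Finset.sum_ite_eq', Finset.mem_univ, if_true] using this
  · intro h f
    simp only [integral_comp_eq_sum_of_finite (hX _), integral_comp_eq_sum_of_finite hZ]
    exact tendsto_finsetSum _ fun e _ => (h e).mul_const _

end MeasureTheory

/-! ## Comparison of the two notions of pattern density along random permutations -/

/-- The vector of all pattern densities of a permutation. -/
abbrev densityVector {n : ℕ} (σ : Equiv.Perm (Fin n)) : AllPerms → ℝ :=
  fun π => occDensity π.2 σ

namespace Permuton

/-- The vector of all pattern densities of a permuton. -/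
abbrev densityVector (μ : Permuton) : AllPerms → ℝ := fun π => occDensity π.2 μ

theorem continuous_densityVector : Continuous densityVector :=
  continuous_pi fun π => continuous_occDensity π.2

/-- The filter `comap Sigma.fst atTop` lets the size tend to infinity uniformly over permutations of
that size, as the bound depends only on the sizes. -/
theorem tendsto_dist_occDensity (π : AllPerms) :
    Tendsto (fun s : AllPerms => dist (_root_.occDensity π.2 s.2) (occDensity π.2 (ofPerm s.2)))
      (comap Sigma.fst atTop) (𝓝 0) := by
  obtain ⟨k, π⟩ := π
  have h1 : Tendsto (fun s : AllPerms => 1 - (Nat.descFactorial s.1 k : ℝ) / (s.1 : ℝ) ^ (k : ℕ))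
      (comap Sigma.fst atTop) (𝓝 0) := by
    have h : Tendsto (fun n : ℕ+ => (n : ℕ)) atTop atTop := tendsto_PNat_val_atTop_atTop
    simpa using ((tendsto_descFactorial_div_pow k).comp (h.comp tendsto_comap)).const_sub 1
  refine squeeze_zero' (Eventually.of_forall fun _ => dist_nonneg) ?_ h1
  filter_upwards [(eventually_ge_atTop k).comap Sigma.fst] with s hs
  exact abs_occDensity_sub_le (by exact_mod_cast hs) π s.2

/-- `F` need not be uniformly continuous on the whole product, but both vectors lie in the compact
cube with coordinates in `[0,1]`, where it is. -/
theorem tendsto_apply_densityVector_sub (F : BoundedContinuousFunction (AllPerms → ℝ) ℝ) :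
    Tendsto (fun s : AllPerms => F (_root_.densityVector s.2) - F (densityVector (ofPerm s.2)))
      (comap Sigma.fst atTop) (𝓝 0) := by
  let K : Set (AllPerms → ℝ) := Set.univ.pi fun _ => Set.Icc 0 1
  have hK : IsCompact K := isCompact_univ_pi fun _ => isCompact_Icc
  have hu := hK.uniformContinuousOn_of_continuous F.continuous.continuousOn
  have ht : Tendsto (fun s : AllPerms => (_root_.densityVector s.2, densityVector (ofPerm s.2)))
      (comap Sigma.fst atTop) (uniformity (AllPerms → ℝ) ⊓ 𝓟 (K ×ˢ K)) := by
    refine tendsto_inf.2 ⟨?_, tendsto_principal.2 (Eventually.of_forall fun s => ?_)⟩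
    · rw [Pi.uniformity]
      refine tendsto_iInf.2 fun π => tendsto_comap_iff.2 ?_
      exact tendsto_uniformity_iff_dist_tendsto_zero.2 (tendsto_dist_occDensity π)
    · exact ⟨fun π _ => ⟨_root_.occDensity_nonneg _ _, _root_.occDensity_le_one _ _⟩,
        fun π _ => ⟨occDensity_nonneg _ _, occDensity_le_one _ _⟩⟩
  have := tendsto_uniformity_iff_dist_tendsto_zero.1 (Tendsto.comp hu ht)
  exact tendsto_zero_iff_abs_tendsto_zero _ |>.2 this

end Permuton

theorem aemeasurable_comp_perm {Ω : ℕ+ → Type*} [∀ n, MeasurableSpace (Ω n)]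
    {P : ∀ n, Measure (Ω n)} {σ : ∀ n : ℕ+, Ω n → Equiv.Perm (Fin n)} {E : Type*}
    [MeasurableSpace E] (hσ : ∀ n, Measurable (σ n)) (f : ∀ n : ℕ+, Equiv.Perm (Fin n) → E)
    (n : ℕ+) : AEMeasurable (fun ω => f n (σ n ω)) (P n) :=
  (Measurable.of_discrete.comp (hσ n)).aemeasurable

section RandomPermutations

variable {Ω : ℕ+ → Type*} [∀ n, MeasurableSpace (Ω n)] {P : ∀ n, Measure (Ω n)}
  [∀ n, IsProbabilityMeasure (P n)] {σ : ∀ n : ℕ+, Ω n → Equiv.Perm (Fin n)}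

theorem tendsto_integral_zero_of_tendsto_comap_fst {g : AllPerms → ℝ}
    (hg : Tendsto g (comap Sigma.fst atTop) (𝓝 0)) :
    Tendsto (fun n => ∫ ω, g ⟨n, σ n ω⟩ ∂(P n)) atTop (𝓝 0) := by
  rw [Metric.tendsto_nhds] at hg ⊢
  intro ε hε
  have h := eventually_comap.1 (hg (ε / 2) (half_pos hε))
  filter_upwards [h] with n hn
  rw [dist_zero_right]
  have := norm_integral_le_of_norm_le_const (μ := P n) (f := fun ω => g ⟨n, σ n ω⟩)
    (C := ε / 2) (ae_of_all _ fun ω => by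
      have := hn ⟨n, σ n ω⟩ rfl
      rw [dist_zero_right] at this
      exact this.le)
  rw [probReal_univ, mul_one] at this
  linarith

theorem integrable_comp_perm (hσ : ∀ n, Measurable (σ n))
    (f : ∀ n : ℕ+, Equiv.Perm (Fin n) → ℝ) (n : ℕ+) : Integrable (fun ω => f n (σ n ω)) (P n) :=
  (Integrable.of_finite (μ := (P n).map (σ n)) (f := f n)).comp_measurable (hσ n)

variable {Ω' : Type*} [MeasurableSpace Ω'] {P' : Measure Ω'} [IsProbabilityMeasure P']

theorem tendsto_integral_occDensity_of_ofPerm (hσ : ∀ n, Measurable (σ n)) (π : AllPerms) {a : ℝ} :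
    Tendsto (fun n => ∫ ω, occDensity π.2 (σ n ω) ∂(P n)) atTop (𝓝 a) ↔
      Tendsto (fun n => ∫ ω, Permuton.occDensity π.2 (Permuton.ofPerm (σ n ω)) ∂(P n)) atTop
        (𝓝 a) := by
  have h0 := tendsto_integral_zero_of_tendsto_comap_fst (P := P) (σ := σ)
    (g := fun s => occDensity π.2 s.2 - Permuton.occDensity π.2 (Permuton.ofPerm s.2))
    ((tendsto_zero_iff_abs_tendsto_zero _).2 (Permuton.tendsto_dist_occDensity π))
  have hsub : ∀ n, ∫ ω, (occDensity π.2 (σ n ω) -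
      Permuton.occDensity π.2 (Permuton.ofPerm (σ n ω))) ∂(P n) =
      ∫ ω, occDensity π.2 (σ n ω) ∂(P n) -
        ∫ ω, Permuton.occDensity π.2 (Permuton.ofPerm (σ n ω)) ∂(P n) := fun n =>
    integral_sub (integrable_comp_perm hσ (fun _ s => occDensity π.2 s) n)
      (integrable_comp_perm hσ (fun _ s => Permuton.occDensity π.2 (Permuton.ofPerm s)) n)
  simp only [hsub] at h0
  constructor
  · intro h
    simpa using h.sub h0
  · intro h
    simpa using h.add h0

theorem tendsto_integral_occDensity_of_permuton (hσ : ∀ n, Measurable (σ n)) {μ : Ω' → Permuton}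
    (h : TendstoInDistribution (fun n ω => Permuton.ofPerm (σ n ω)) atTop μ P P')
    (π : AllPerms) :
    Tendsto (fun n => ∫ ω, occDensity π.2 (σ n ω) ∂(P n)) atTop
      (𝓝 (∫ ω, Permuton.occDensity π.2 (μ ω) ∂P')) := by
  rw [tendsto_integral_occDensity_of_ofPerm hσ]
  exact h.tendsto_integral (BoundedContinuousFunction.mkOfCompact (Permuton.occMap π))

theorem tendstoInDistribution_densityVector (hσ : ∀ n, Measurable (σ n)) {μ : Ω' → Permuton}
    (h : TendstoInDistribution (fun n ω => Permuton.ofPerm (σ n ω)) atTop μ P P') :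
    TendstoInDistribution (fun n ω => densityVector (σ n ω)) atTop
      (fun ω => Permuton.densityVector (μ ω)) P P' := by
  refine (tendstoInDistribution_iff_forall_integral_tendsto
    (aemeasurable_comp_perm hσ fun _ s => densityVector s)
    (Permuton.continuous_densityVector.measurable.comp_aemeasurable h.aemeasurable_limit)).2
    fun F => ?_
  have h0 := tendsto_integral_zero_of_tendsto_comap_fst (P := P) (σ := σ)
    (Permuton.tendsto_apply_densityVector_sub F)
  have hsub : ∀ n, ∫ ω, (F (densityVector (σ n ω)) -
      F (Permuton.densityVector (Permuton.ofPerm (σ n ω)))) ∂(P n) =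
      ∫ ω, F (densityVector (σ n ω)) ∂(P n) -
        ∫ ω, F (Permuton.densityVector (Permuton.ofPerm (σ n ω))) ∂(P n) := fun n =>
    integral_sub (integrable_comp_perm hσ (fun _ s => F (densityVector s)) n)
      (integrable_comp_perm hσ
        (fun _ s => F (Permuton.densityVector (Permuton.ofPerm s))) n)
  simp only [hsub] at h0
  have h1 := h.tendsto_integral
    (F.compContinuous ⟨Permuton.densityVector, Permuton.continuous_densityVector⟩)
  simpa using h0.add h1

/-- A coordinate is not a bounded test function, so it is truncated to `[0,1]`. Truncation leaves
actual densities unchanged and makes the limit nonnegative whatever `Λ` is. -/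
theorem tendsto_integral_occDensity_of_densityVector {Λ : Ω' → AllPerms → ℝ}
    (h : TendstoInDistribution (fun n ω => densityVector (σ n ω)) atTop Λ P P') (π : AllPerms) :
    Tendsto (fun n => ∫ ω, occDensity π.2 (σ n ω) ∂(P n)) atTop
      (𝓝 (∫ ω, max 0 (min 1 (Λ ω π)) ∂P')) := by
  let F : BoundedContinuousFunction (AllPerms → ℝ) ℝ :=
    BoundedContinuousFunction.mkOfBound ⟨fun x => max 0 (min 1 (x π)), by fun_prop⟩ 1 (by
      intro x y
      have := Real.dist_le_of_mem_Icc_01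
        (x := max 0 (min 1 (x π))) (y := max 0 (min 1 (y π))) (by simp) (by simp)
      exact this)
  have := h.tendsto_integral F
  refine this.congr fun n => integral_congr_ae (ae_of_all _ fun ω => ?_)
  change max 0 (min 1 (occDensity π.2 (σ n ω))) = _
  rw [min_eq_right (occDensity_le_one _ _), max_eq_right (occDensity_nonneg _ _)]

/-- Convergence of the expected pattern densities implies convergence in distribution of the
associated permutons. -/
theorem exists_tendstoInDistribution_ofPerm (hσ : ∀ n, Measurable (σ n)) {Δ : AllPerms → ℝ}
    (h : ∀ π : AllPerms,
      Tendsto (fun n => ∫ ω, occDensity π.2 (σ n ω) ∂(P n)) atTop (𝓝 (Δ π))) :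
    ∃ (Q : Measure Permuton) (_ : IsProbabilityMeasure Q),
      TendstoInDistribution (fun n ω => Permuton.ofPerm (σ n ω)) atTop id P Q := by
  have hX := aemeasurable_comp_perm (P := P) hσ fun _ s => Permuton.ofPerm s
  let L : ℕ+ → ProbabilityMeasure Permuton := fun n =>
    ⟨(P n).map fun ω => Permuton.ofPerm (σ n ω), Measure.isProbabilityMeasure_map (hX n)⟩
  have hL : ∀ π : AllPerms,
      Tendsto (fun n => ∫ μ, Permuton.occDensity π.2 μ ∂(L n : Measure Permuton)) atTop
        (𝓝 (Δ π)) := by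
    intro π
    refine ((tendsto_integral_occDensity_of_ofPerm hσ π).1 (h π)).congr fun n => ?_
    exact (integral_map (hX n)
      (Permuton.continuous_occDensity π.2).measurable.aestronglyMeasurable).symm
  -- Expected densities are continuous in the law, so at any cluster point they take the limiting
  -- values `Δ`.
  have hcl : ∀ (Q : ProbabilityMeasure Permuton), MapClusterPt Q atTop L → ∀ π : AllPerms,
      ∫ μ, Permuton.occDensity π.2 μ ∂(Q : Measure Permuton) = Δ π := by
    intro Q hQ π
    have hc : Continuous fun Q : ProbabilityMeasure Permuton =>
        ∫ μ, Permuton.occDensity π.2 μ ∂(Q : Measure Permuton) :=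
      ProbabilityMeasure.continuous_integral_boundedContinuousFunction
        (BoundedContinuousFunction.mkOfCompact (Permuton.occMap π))
    have h1 := hQ.tendsto_comp hc.continuousAt
    have h2 : ClusterPt _ (𝓝 (Δ π)) := ClusterPt.mono h1 (hL π)
    exact eq_of_nhds_neBot h2
  obtain ⟨Q, hQ⟩ : ∃ Q, MapClusterPt Q atTop L := exists_clusterPt_of_compactSpace _
  -- In a compact space, a sequence with a unique cluster point converges to it.
  have hlim : Tendsto L atTop (𝓝 Q) := tendsto_nhds_of_unique_mapClusterPt fun Q' hQ' => by
    have : (Q' : Measure Permuton) = Q := Permuton.measure_eq_of_integral_occDensity_eq fun π =>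
      (hcl Q' hQ' π).trans (hcl Q hQ π).symm
    exact Subtype.ext this
  refine ⟨Q, inferInstance, hX, aemeasurable_id, ?_⟩
  have hQid : (⟨(Q : Measure Permuton).map id,
      Measure.isProbabilityMeasure_map aemeasurable_id⟩ : ProbabilityMeasure Permuton) = Q :=
    Subtype.ext (Measure.map_id (μ := (Q : Measure Permuton)))
  rw [hQid]
  exact hlim

end RandomPermutations

/-! ## Sampling -/

theorem Permuton.jointSampleLaw_real (Q : Measure Permuton) [IsProbabilityMeasure Q] {k : ℕ}
    (π : Equiv.Perm (Fin k)) :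
    (Permuton.jointSampleLaw Q k).real {p | Permuton.permOfPoints p.2 = π} =
      ∫ μ, Permuton.occDensity π μ ∂Q := by
  have hm : MeasurableSet {z : Fin k → UnitSquare | permOfPoints z = π} :=
    measurable_permOfPoints (measurableSet_singleton _)
  have hS : MeasurableSet {p : Permuton × (Fin k → UnitSquare) | permOfPoints p.2 = π} :=
    measurable_snd hm
  rw [measureReal_def, jointSampleLaw, Measure.compProd_apply hS,
    integral_eq_lintegral_of_nonneg_ae (ae_of_all _ fun μ => occDensity_nonneg π μ)
      (continuous_occDensity π).measurable.aestronglyMeasurable]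
  congr 1
  refine lintegral_congr fun μ => ?_
  exact (ENNReal.ofReal_toReal (measure_ne_top (μ.sample k) {z | permOfPoints z = π})).symm

/-- By independence `σ` can be frozen first; the uniform set `I` then hits an occurrence with
probability equal to the count divided by the number of subsets. -/
theorem inducedPattern_real_eq {Ω : Type*} [MeasurableSpace Ω] {P : Measure Ω}
    [IsProbabilityMeasure P] {n k : ℕ} {σ : Ω → Equiv.Perm (Fin n)} (hσ : Measurable σ)
    {I : Ω → Set.powersetCard (Fin n) k} (hI : Measurable I)
    (hunif : P.map I = uniformOn Set.univ) (hindep : IndepFun I σ P) (π : Equiv.Perm (Fin k)) :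
    P.real {ω | inducedPattern (σ ω) (I ω) = π} = ∫ ω, occDensity π (σ ω) ∂P := by
  have hprod := (indepFun_iff_map_prod_eq_prod_map_map hI.aemeasurable hσ.aemeasurable).1 hindep
  have hS : MeasurableSet {p : Set.powersetCard (Fin n) k × Equiv.Perm (Fin n) |
    inducedPattern p.2 p.1 = π} := (Set.toFinite _).measurableSet
  have h1 : P {ω | inducedPattern (σ ω) (I ω) = π} =
      ((P.map I).prod (P.map σ)) {p | inducedPattern p.2 p.1 = π} := by
    rw [← hprod, Measure.map_apply (hI.prodMk hσ) hS]
    rfl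
  have hp := Measure.isProbabilityMeasure_map (μ := P) hσ.aemeasurable
  have hp' := Measure.isProbabilityMeasure_map (μ := P) hI.aemeasurable
  rw [measureReal_def, h1, Measure.prod_apply_symm hS,
    ← integral_map (f := fun s => occDensity π s) hσ.aemeasurable
      Measurable.of_discrete.aestronglyMeasurable,
    integral_eq_lintegral_of_nonneg_ae (ae_of_all _ fun s => occDensity_nonneg π s)
      Measurable.of_discrete.aestronglyMeasurable]
  congr 1
  refine lintegral_congr fun s => ?_
  rw [hunif, uniformOn_univ, ← Nat.card_eq_fintype_card, natCard_powersetCard,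
    Measure.count_apply_finite _ (Set.toFinite _), ← Set.ncard_eq_toFinset_card]
  -- The existence of the random subset `I` already rules out `n < k`.
  have h0 : (0 : ℝ) < n.choose k := by
    have : Nonempty (Set.powersetCard (Fin n) k) := (nonempty_of_isProbabilityMeasure P).map I
    have := Nat.card_pos (α := Set.powersetCard (Fin n) k)
    rw [natCard_powersetCard] at this
    exact_mod_cast this
  rw [occDensity, ENNReal.ofReal_div_of_pos h0, ENNReal.ofReal_natCast, ENNReal.ofReal_natCast]
  rfl

end

/-! ### The equivalences and the identification of the limits. -/

theorem mainTheorem2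
    {Ω : ℕ+ → Type*} [∀ n, MeasurableSpace (Ω n)]
    (P : ∀ n, Measure (Ω n)) [∀ n, IsProbabilityMeasure (P n)]
    -- `σ n` is a random permutation of size `n`
    (σ : ∀ n : ℕ+, Ω n → Equiv.Perm (Fin n)) (hσ : ∀ n, Measurable (σ n))
    -- `I n k` (for `k ≤ n`) is a uniform random subset of `[n]` with `k` elements,
    -- independent of `σ n`
    (I : ∀ n k : ℕ+, k ≤ n → Ω n → Set.powersetCard (Fin n) k)
    (hI : ∀ n k h, Measurable (I n k h))
    (hI_unif : ∀ n k h, (P n).map (I n k h) = uniformOn Set.univ)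
    (hI_indep : ∀ n k h, IndepFun (I n k h) (σ n) (P n)) :
    List.TFAE [
      -- (a)
      ∃ (Ω' : Type) (_ : MeasurableSpace Ω') (P' : Measure Ω') (_ : IsProbabilityMeasure P')
        (μ : Ω' → Permuton),
        TendstoInDistribution (fun n ω => Permuton.ofPerm (σ n ω)) atTop μ P P',
      -- (b)
      ∃ (Ω' : Type) (_ : MeasurableSpace Ω') (P' : Measure Ω') (_ : IsProbabilityMeasure P')
        (Λ : Ω' → AllPerms → ℝ),
        TendstoInDistribution (fun n ω (π : AllPerms) => occDensity π.2 (σ n ω)) atTop Λ P P',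
      -- (c)
      ∀ π : AllPerms, ∃ Δ : ℝ, 0 ≤ Δ ∧
        Tendsto (fun n => ∫ ω, occDensity π.2 (σ n ω) ∂(P n)) atTop (𝓝 Δ),
      -- (d)
      ∀ k : ℕ+, ∃ (Ω' : Type) (_ : MeasurableSpace Ω') (P' : Measure Ω')
        (_ : IsProbabilityMeasure P') (ρ : Ω' → Equiv.Perm (Fin k)),
        TendstoInDistribution
          (fun (n : Set.Ici k) (ω : Ω n) => inducedPattern (σ n ω) (I n k n.2 ω))
          atTop ρ (fun n => P n) P'] ∧
    -- identification of the limits, whenever they exist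
    ∀ {Ωμ : Type*} [MeasurableSpace Ωμ] (Pμ : Measure Ωμ) [IsProbabilityMeasure Pμ]
      (μ : Ωμ → Permuton)
      {ΩΛ : Type*} [MeasurableSpace ΩΛ] (PΛ : Measure ΩΛ) [IsProbabilityMeasure PΛ]
      (Λ : ΩΛ → AllPerms → ℝ)
      (Δ : AllPerms → ℝ)
      {Ωρ : ℕ+ → Type*} [∀ k, MeasurableSpace (Ωρ k)] (Pρ : ∀ k, Measure (Ωρ k))
      [∀ k, IsProbabilityMeasure (Pρ k)] (ρ : ∀ k : ℕ+, Ωρ k → Equiv.Perm (Fin k)),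
      TendstoInDistribution (fun n ω => Permuton.ofPerm (σ n ω)) atTop μ P Pμ →
      TendstoInDistribution (fun n ω (π : AllPerms) => occDensity π.2 (σ n ω)) atTop Λ P PΛ →
      (∀ π : AllPerms,
        Tendsto (fun n => ∫ ω, occDensity π.2 (σ n ω) ∂(P n)) atTop (𝓝 (Δ π))) →
      (∀ k : ℕ+, TendstoInDistribution
        (fun (n : Set.Ici k) (ω : Ω n) => inducedPattern (σ n ω) (I n k n.2 ω))
        atTop (ρ k) (fun n => P n) (Pρ k)) →
      IdentDistrib Λ (fun ω (π : AllPerms) => Permuton.occDensity π.2 (μ ω)) PΛ Pμ ∧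
      ∀ (k : ℕ+) (π : Equiv.Perm (Fin k)),
        (Pρ k).real {ω | ρ k ω = π} = Δ ⟨k, π⟩ ∧
        Integrable (fun ω => Λ ω ⟨k, π⟩) PΛ ∧
        Δ ⟨k, π⟩ = ∫ ω, Λ ω ⟨k, π⟩ ∂PΛ ∧
        Integrable (fun ω => Permuton.occDensity π (μ ω)) Pμ ∧
        ∫ ω, Λ ω ⟨k, π⟩ ∂PΛ = ∫ ω, Permuton.occDensity π (μ ω) ∂Pμ ∧
        ∫ ω, Permuton.occDensity π (μ ω) ∂Pμ =
          (Permuton.jointSampleLaw (Pμ.map μ) k).real {p | Permuton.permOfPoints p.2 = π} := by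
  have hden := fun (k n : ℕ+) (h : k ≤ n) (π : Equiv.Perm (Fin k)) =>
    inducedPattern_real_eq (P := P n) (hσ n) (hI n k h) (hI_unif n k h) (hI_indep n k h) π
  have hpm : ∀ (k : ℕ+) (n : Set.Ici k),
      AEMeasurable (fun ω => inducedPattern (σ n ω) (I n k n.2 ω)) (P n) := fun k n =>
    ((Measurable.of_discrete (f := fun p : Set.powersetCard (Fin n) k × Equiv.Perm (Fin n) =>
      inducedPattern p.2 p.1)).comp ((hI n k n.2).prodMk (hσ n))).aemeasurable (μ := P n)
  have hpat : ∀ (k : ℕ+) (π : Equiv.Perm (Fin k)) (a : ℝ),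
      Tendsto (fun n : Set.Ici k => (P n).real {ω | inducedPattern (σ n ω) (I n k n.2 ω) = π})
        atTop (𝓝 a) ↔
      Tendsto (fun n => ∫ ω, occDensity π (σ n ω) ∂(P n)) atTop (𝓝 a) := by
    intro k π a
    -- Restricting to sizes at least `k` does not affect limits at infinity.
    rw [← tendsto_comp_val_Ici_atTop (a := k)]
    exact tendsto_congr fun n => hden k n n.2 π
  refine ⟨?_, ?_⟩
  · tfae_have 1 → 2 := by
      rintro ⟨Ω', _, P', _, μ, h⟩
      exact ⟨Ω', _, P', _, _, tendstoInDistribution_densityVector hσ h⟩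
    tfae_have 2 → 3 := by
      rintro ⟨Ω', _, P', _, Λ, h⟩ π
      exact ⟨_, integral_nonneg fun ω => le_max_left _ _,
        tendsto_integral_occDensity_of_densityVector h π⟩
    tfae_have 3 → 1 := by
      intro h
      choose Δ _ hΔ using h
      obtain ⟨Q, _, hQ⟩ := exists_tendstoInDistribution_ofPerm hσ hΔ
      exact ⟨Permuton, _, Q, _, id, hQ⟩
    tfae_have 1 → 4 := by
      rintro ⟨Ω', _, P', _, μ, h⟩ k
      have hQ := Measure.isProbabilityMeasure_map h.aemeasurable_limit
      have hJ : IsProbabilityMeasure (Permuton.jointSampleLaw (P'.map μ) k) := by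
        unfold Permuton.jointSampleLaw
        infer_instance
      -- The limiting pattern is the one induced by `k` points sampled from the limiting random
      -- permuton.
      refine ⟨Permuton × (Fin k → UnitSquare), _, Permuton.jointSampleLaw (P'.map μ) k, hJ,
        fun p => Permuton.permOfPoints p.2, ?_⟩
      refine (tendstoInDistribution_iff_of_finite (hpm k)
        (Permuton.measurable_permOfPoints.comp measurable_snd).aemeasurable).2 fun π => ?_
      have hlim : (Permuton.jointSampleLaw (P'.map μ) k).real {p | Permuton.permOfPoints p.2 = π} =
          ∫ ω, Permuton.occDensity π (μ ω) ∂P' := by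
        rw [Permuton.jointSampleLaw_real, integral_map h.aemeasurable_limit
          (Permuton.continuous_occDensity π).measurable.aestronglyMeasurable]
      refine (hpat k π _).2 ?_
      change Tendsto _ _ (𝓝 ((Permuton.jointSampleLaw (P'.map μ) k).real
        {p | Permuton.permOfPoints p.2 = π}))
      rw [hlim]
      exact tendsto_integral_occDensity_of_permuton hσ h ⟨k, π⟩
    tfae_have 4 → 3 := by
      rintro h ⟨k, π⟩
      obtain ⟨Ω', _, P', _, ρ, h⟩ := h k
      have h' := (tendstoInDistribution_iff_of_finite (hpm k) h.aemeasurable_limit).1 h π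
      exact ⟨_, measureReal_nonneg, (hpat k π _).1 h'⟩
    tfae_finish
  · intro Ωμ _ Pμ _ μ ΩΛ _ PΛ _ Λ Δ Ωρ _ Pρ _ ρ hμ hΛ hΔ hρ
    have hid : IdentDistrib Λ (fun ω (π : AllPerms) => Permuton.occDensity π.2 (μ ω)) PΛ Pμ :=
      ⟨hΛ.aemeasurable_limit, (tendstoInDistribution_densityVector hσ hμ).aemeasurable_limit,
        tendstoInDistribution_unique _ hΛ (tendstoInDistribution_densityVector hσ hμ)⟩
    refine ⟨hid, fun k π => ?_⟩
    -- Nothing bounds `Λ` a priori; its integrability and mean are transferred from the permuton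
    -- densities through equality in law.
    have hid' := hid.comp (measurable_pi_apply (⟨k, π⟩ : AllPerms))
    have hΔμ := tendsto_nhds_unique (hΔ ⟨k, π⟩)
      (tendsto_integral_occDensity_of_permuton hσ hμ ⟨k, π⟩)
    have hintμ : Integrable (fun ω => Permuton.occDensity π (μ ω)) Pμ := by
      refine Integrable.of_bound ((Permuton.continuous_occDensity π).measurable.comp_aemeasurable
        hμ.aemeasurable_limit).aestronglyMeasurable 1 (ae_of_all _ fun ω => ?_)
      rw [Real.norm_of_nonneg (Permuton.occDensity_nonneg _ _)]
      exact Permuton.occDensity_le_one _ _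
    have hρ' := (tendstoInDistribution_iff_of_finite (hpm k) (hρ k).aemeasurable_limit).1 (hρ k) π
    have hQ := Measure.isProbabilityMeasure_map hμ.aemeasurable_limit
    refine ⟨tendsto_nhds_unique ((hpat k π _).1 hρ') (hΔ ⟨k, π⟩), hid'.integrable_iff.2 hintμ,
      hΔμ.trans hid'.integral_eq.symm, hintμ, hid'.integral_eq, ?_⟩
    rw [Permuton.jointSampleLaw_real, integral_map hμ.aemeasurable_limit
        (Permuton.continuous_occDensity π).measurable.aestronglyMeasurable]
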